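/- Fix a tuple $\mathfrak U=\langle S;P_1,\dots,P_r;L_1,\dots,L_r\rangle$, where $S$ is a countable set of positive real numbers, each $P_i$ is a relation symbol of arity $k_i\ge 1$, and $L_i\le \mathrm{Sym}(k_i)$. Let $L_{\mathfrak U}$ be the relational language $\{E_s : s\in S\}\cup\{P_1,\dots,P_r\}$ with each $E_s$ binary. An $L_{\mathfrak U}$-structure $X$ is a *$\mathfrak U$-structure* if (1) each $P_i^X$ is $L_i$-symmetric, i.e. $P_i^X(x_{\vartheta(1)},\dots,x_{\vartheta(k_i)})\Leftrightarrow P_i^X(x_1,\dots,x_{k_i})$ for all $\vartheta\in L_i$; (2) $P_i^X(x_1,\dots,x_{k_i})$ implies that $x_1,\dots,x_{k_i}$ are distinct; (3) each $E_s^X$ is an equivalence relation; (4) $E_s^X\subseteq E_t^X$ whenever $s<t$; (5) if $S\neq\emptyset$, then for all $x\ne y$ in $X$ there is a maximal $s\in S$ with $(x,y)\notin E_s^X$. Let $\mathbf U$ be the randomised ultrametric space corresponding to $\mathfrak U$, i.e. the Fraïssé limit of the class of finite $\mathfrak U$-structures (the unique, up to isomorphism, countable ultrahomogeneous $L_{\mathfrak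 U}$-structure whose age is this class). Equip $\mathrm{Aut}(\mathbf U)$ with the topology of pointwise convergence ($\mathbf U$ being discrete) and, for a countable group $\Gamma$, let $\mathsf{Rep}(\Gamma,\mathbf U)$ be the space of homomorphisms $\Gamma\to\mathrm{Aut}(\mathbf U)$ with the topology inherited from $\mathrm{Aut}(\mathbf U)^\Gamma$. A representation $\pi\in\mathsf{Rep}(\Gamma,\mathbf U)$ is *generic* if its orbit under conjugation by $\mathrm{Aut}(\mathbf U)$ is comeagre in $\mathsf{Rep}(\Gamma,\mathbf U)$. For subgroups $\Delta,\Lambda\le\Gamma$ view $\mathsf{Rep}(\langle\Delta,\Lambda\rangle,\mathbf U)$ as a subset of $\mathsf{Rep}(\Delta,\mathbf U)\times\mathsf{Rep}(\Lambda,\mathbf U)$ through $\rho\mapsto(\rho|_\Delta,\rho|_\Lambda)$, write $\pi\times\sigma$ for the element with restrictions $\pi$ and $\sigma$, and for $\pi\in\mathsf{Rep}(\Delta,\mathbf U)$ let $\mathsf{Rep}(\Lambda,\mathbf U)_\pi$ be the fibre $\{\sigma\in\mathsf{Rep}(\Lambda,\mathbf U) : \pi\times\sigma\in\mathsf{Rep}(\langle\Delta,\Lambda\rangle,\mathbf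 U)\}$ with the subspace topology. **Theorem.** Let $\Gamma$ be a finitely generated abelian group. Then there is a generic representation $\pi$ in $\mathsf{Rep}(\Gamma,\mathbf U)$ such that every orbit of $\Gamma$ on $\mathbf U$ under the action $\pi$ is finite. Also, if $\Delta$ and $\Lambda$ are finitely generated subgroups of $\Gamma$, then for comeagrely many $\pi\in\mathsf{Rep}(\Delta,\mathbf U)$ and, for each such $\pi$, comeagrely many $\sigma\in\mathsf{Rep}(\Lambda,\mathbf U)_\pi$, the representation $\pi\times\sigma$ is generic in $\mathsf{Rep}(\langle\Delta,\Lambda\rangle,\mathbf U)$. -/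

import Mathlib

open scoped FirstOrder

universe w

/-! ### Representations of a discrete group in a topological group -/

/-- The space of representations of `Γ` in `G`. -/
def RepSpace (Γ : Type*) [Group Γ] (G : Type*) [Group G] : Type _ := Γ →* G

namespace RepSpace

variable {Γ : Type*} [Group Γ] {G : Type*} [Group G]

instance : FunLike (RepSpace Γ G) Γ G := inferInstanceAs (FunLike (Γ →* G) Γ G)

instance : MonoidHomClass (RepSpace Γ G) Γ G := inferInstanceAs (MonoidHomClass (Γ →* G) Γ G)

/-- The topology inherited from the product space `G ^ Γ`. -/
instance [TopologicalSpace G] : TopologicalSpace (RepSpace Γ G) :=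
  TopologicalSpace.induced (fun (π : RepSpace Γ G) (γ : Γ) => π γ) inferInstance

/-- The orbit of a representation under the action of `G` by conjugation. -/
def orbit (π : RepSpace Γ G) : Set (RepSpace Γ G) :=
  {θ | ∃ g : G, ∀ γ : Γ, θ γ = g * π γ * g⁻¹}

/-- A representation is generic if its conjugacy class is comeagre. -/
def IsGeneric [TopologicalSpace G] (π : RepSpace Γ G) : Prop :=
  π.orbit ∈ residual (RepSpace Γ G)

/-- Restriction of a representation to a smaller subgroup. -/
def restrict {Δ Δ' : Subgroup Γ} (h : Δ ≤ Δ') (ρ : RepSpace Δ' G) : RepSpace Δ G :=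
  MonoidHom.comp (show Δ' →* G from ρ) (Subgroup.inclusion h)

/-- `IsProd π σ ρ` says that the representation `ρ` of `⟨Δ, Λ⟩` is `π × σ`, that is, `ρ` is
the (necessarily unique) representation of `⟨Δ, Λ⟩` which restricts to `π` on `Δ` and
to `σ` on `Λ`. -/
def IsProd {Δ Λ : Subgroup Γ} (π : RepSpace Δ G) (σ : RepSpace Λ G) (ρ : RepSpace ↥(Δ ⊔ Λ) G) : Prop :=
  ρ.restrict le_sup_left = π ∧ ρ.restrict le_sup_right = σ

/-- The fibre `Rep(Λ, G)_π` over `π` of `Rep(⟨Δ, Λ⟩, G)`, the latter being seen as a subset of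
`Rep(Δ, G) × Rep(Λ, G)`. As a subtype of `RepSpace Λ G` it carries the subspace topology. -/
def fibre {Δ : Subgroup Γ} (Λ : Subgroup Γ) (π : RepSpace Δ G) : Set (RepSpace Λ G) :=
  {σ | ∃ ρ : RepSpace ↥(Δ ⊔ Λ) G, IsProd π σ ρ}

end RepSpace

/-! ### Automorphism groups of structures -/

/-- The automorphism group of a first-order structure. -/
def AutGroup (L : FirstOrder.Language) (M : Type*) [L.Structure M] : Type _ := M ≃[L] M

namespace AutGroup

variable {L : FirstOrder.Language} {M : Type*} [L.Structure M]

instance : EquivLike (AutGroup L M) M M := inferInstanceAs (EquivLike (M ≃[L] M) M M)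

/-- The group operation is composition: `(g * h) x = g (h x)`. -/
instance : Group (AutGroup L M) where
  mul g h := FirstOrder.Language.Equiv.comp (show M ≃[L] M from g) (show M ≃[L] M from h)
  one := FirstOrder.Language.Equiv.refl L M
  inv g := FirstOrder.Language.Equiv.symm (show M ≃[L] M from g)
  mul_assoc _ _ _ := rfl
  one_mul _ := rfl
  mul_one _ := rfl
  inv_mul_cancel g := FirstOrder.Language.Equiv.symm_comp_self (show M ≃[L] M from g)

/-- The topology of pointwise convergence, where the structure is taken discrete. -/
instance : TopologicalSpace (AutGroup L M) :=
  TopologicalSpace.induced (fun (g : AutGroup L M) (x : M) => g x)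
    (@Pi.topologicalSpace M (fun _ => M) (fun _ => ⊥))

end AutGroup

/-! ### Randomised ultrametric spaces -/

/-- A tuple `𝔘 = ⟨S; P₁, …, P_r; L₁, …, L_r⟩`: a countable set `S` of positive reals, finitely
many relation symbols `P i` (given by their arities), and for each of them a subgroup of the
symmetric group on its argument places. -/
structure UTuple where
  S : Set ℝ
  S_countable : S.Countable
  S_pos : ∀ s ∈ S, 0 < s
  r : ℕ
  arity : Fin r → ℕ
  arity_pos : ∀ i, 0 < arity i
  sym : ∀ i, Subgroup (Equiv.Perm (Fin (arity i)))

namespace UTuple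

/-- The relation symbols of the language of `𝔘`: a binary symbol `E s` for each `s ∈ S`, and
the symbols `P i`. -/
inductive Symb (𝔘 : UTuple) : ℕ → Type
  | E (s : 𝔘.S) : Symb 𝔘 2
  | P (i : Fin 𝔘.r) : Symb 𝔘 (𝔘.arity i)

/-- The relational language `L_𝔘`. -/
def lang (𝔘 : UTuple) : FirstOrder.Language.{0, 0} where
  Functions := fun _ => Empty
  Relations := 𝔘.Symb

instance (𝔘 : UTuple) : Countable (Σ l, 𝔘.lang.Functions l) :=
  haveI : IsEmpty (Σ l, 𝔘.lang.Functions l) := ⟨fun x => Empty.elim x.2⟩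
  inferInstance

section

variable (𝔘 : UTuple) {M : Type*} [𝔘.lang.Structure M]

/-- The interpretation of the symbol `E s`. -/
def relE (s : 𝔘.S) (x y : M) : Prop :=
  FirstOrder.Language.Structure.RelMap (L := 𝔘.lang) (Symb.E s : 𝔘.lang.Relations 2) ![x, y]

/-- The interpretation of the symbol `P i`. -/
def relP (i : Fin 𝔘.r) (x : Fin (𝔘.arity i) → M) : Prop :=
  FirstOrder.Language.Structure.RelMap (L := 𝔘.lang)
    (Symb.P i : 𝔘.lang.Relations (𝔘.arity i)) x

end

/-- `𝔘`-structures. The condition `exists_dist` (the maximal `s` is the distance of `x` and `y`)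
is void when `S` is empty, in which case the structure carries only the relations `P i`. -/
structure IsUStructure (𝔘 : UTuple) (M : Type*) [𝔘.lang.Structure M] : Prop where
  symm : ∀ (i : Fin 𝔘.r), ∀ ϑ ∈ 𝔘.sym i, ∀ x : Fin (𝔘.arity i) → M,
    𝔘.relP i (fun j => x (ϑ j)) ↔ 𝔘.relP i x
  distinct : ∀ (i : Fin 𝔘.r) (x : Fin (𝔘.arity i) → M), 𝔘.relP i x → Function.Injective x
  equiv : ∀ s : 𝔘.S, Equivalence (𝔘.relE (M := M) s)
  nested : ∀ s t : 𝔘.S, s < t → ∀ x y : M, 𝔘.relE s x y → 𝔘.relE t x y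
  exists_dist : 𝔘.S.Nonempty → ∀ x y : M, x ≠ y →
    ∃ s : 𝔘.S, IsGreatest {t : 𝔘.S | ¬ 𝔘.relE t x y} s

/-- The class `𝒦_𝔘` of finite `𝔘`-structures. -/
def finiteStructures (𝔘 : UTuple) : Set (CategoryTheory.Bundled.{w} 𝔘.lang.Structure) :=
  {N | Finite N ∧ 𝔘.IsUStructure N}

/-- `M` is the randomised ultrametric space corresponding to `𝔘`: the (unique up to isomorphism)
countable ultrahomogeneous structure whose age is the class of finite `𝔘`-structures. -/
def IsRandomisedUltrametricSpace (𝔘 : UTuple) (M : Type*) [𝔘.lang.Structure M]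
    [Countable M] : Prop :=
  FirstOrder.Language.IsFraisseLimit 𝔘.finiteStructures M

end UTuple

universe u v

/-! ### Separability of subgroups of finitely generated abelian groups -/

/-! Genericity comes from a Fraïssé-type extension property, `UTuple.IsExtensive`: orbits are
finite, and every finite action extending the restriction to a finite invariant set is realised over
that set. A back-and-forth along finite invariant sets makes any two such representations conjugate
(`IsExtensive.exists_conj`). They exist as limits of generic chains of finite actions
(`FinAct.exists_isExtensive`), and a category argument makes them comeagre wherever they are dense
(`eventually_residual_isExtensive`).

Everything rests on producing finite `Γ`-structures. The `Γ`-set generated by a finite set is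
divided by the group of `N`-th powers, which has finite index. Relations between the generators are
described by cosets in `Γ`, and an empty intersection of cosets stays empty after thickening by
`N`-th powers for suitable `N`, because subgroups of finitely generated abelian groups are closed in
the profinite topology. Distances are rounded to a finite set, so that only finitely many cosets
matter. The resulting `exists_finite_quotient` has two uses: a finite part of any action lies in a
finite action (`exists_finite_approx`), and a finite `Γ`-structure and a finite `Δ`-structure
amalgamate over a common `Δ`-substructure (`exists_equivariant_amalgam`).

Amalgamation along a subgroup shows that the extension property passes to restrictions
(`IsExtensive.comp`). Together with conjugacy over finite sets, this makes extensive representations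
dense among the extensions of a fixed extensive `π` (`IsExtensive.exists_extension`), which is the
density needed in the fibre over `π`. -/

theorem CommGroup.exists_not_pow_of_ne_one {G : Type*} [CommGroup G] [Group.FG G] {g : G}
    (hg : g ≠ 1) : ∃ M : ℕ, 0 < M ∧ ∀ a : G, a ^ M ≠ g := by
  obtain ⟨ι, j, _, _, p, hp, e, ⟨f⟩⟩ := CommGroup.equiv_free_prod_prod_multiplicative_zmod G
  by_contra! H
  apply hg
  apply f.injective
  rw [map_one]
  refine Prod.ext (funext fun i => ?_) ?_
  · by_contra hne
    set v : ℤ := Multiplicative.toAdd ((f g).1 i) with hv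
    have hv0 : v ≠ 0 := fun h => hne (Multiplicative.toAdd.injective h)
    -- A nonzero integer `v` is not divisible by `|v| + 1`.
    obtain ⟨a, ha⟩ := H (v.natAbs + 1) (Nat.succ_pos _)
    have h1 : v = (v.natAbs + 1 : ℕ) * Multiplicative.toAdd ((f a).1 i) := by
      have h0 : (f g).1 i = (f a).1 i ^ (v.natAbs + 1) := by
        conv_lhs => rw [← ha, map_pow, Prod.pow_fst, Pi.pow_apply]
      exact hv.trans ((congrArg Multiplicative.toAdd h0).trans (by rw [toAdd_pow, nsmul_eq_mul]))
    have h2 : ((v.natAbs + 1 : ℕ) : ℤ) ∣ v := ⟨_, h1⟩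
    have h3 := Int.natAbs_dvd_natAbs.2 h2
    have h4 := Nat.le_of_dvd (Int.natAbs_pos.2 hv0) h3
    simp only [Int.natAbs_natCast] at h4
    omega
  -- This exponent annihilates the torsion factor.
  · obtain ⟨a, ha⟩ := H (∏ i, p i ^ e i) (Finset.prod_pos fun i _ => pow_pos (hp i).pos _)
    rw [← ha, map_pow]
    funext i
    apply Multiplicative.toAdd.injective
    obtain ⟨k, hk⟩ := Finset.dvd_prod_of_mem (fun i => p i ^ e i) (Finset.mem_univ i)
    simp [toAdd_pow, hk]

theorem CommGroup.exists_mul_pow_notMem {G : Type*} [CommGroup G] [Group.FG G] (D : Subgroup G)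
    {g : G} (hg : g ∉ D) : ∃ M : ℕ, 0 < M ∧ ∀ N, M ∣ N → ∀ a : G, g * a ^ N ∉ D := by
  have hg' : (QuotientGroup.mk g : G ⧸ D) ≠ 1 := fun h => hg ((QuotientGroup.eq_one_iff g).1 h)
  obtain ⟨M, hM, h⟩ := CommGroup.exists_not_pow_of_ne_one hg'
  refine ⟨M, hM, ?_⟩
  rintro N ⟨k, rfl⟩ a ha
  apply h (QuotientGroup.mk (a ^ k))⁻¹
  have h1 : (QuotientGroup.mk (g * a ^ (M * k)) : G ⧸ D) = 1 := (QuotientGroup.eq_one_iff _).2 ha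
  rw [QuotientGroup.mk_mul] at h1
  rw [eq_comm, eq_inv_of_mul_eq_one_left h1, inv_pow, mul_comm M k, pow_mul]
  rfl

/-- Finitely many cosets with empty intersection in a finitely generated abelian group have
closures with empty intersection in the profinite topology. -/
theorem CommGroup.exists_forall_mul_pow_mem_imp {G : Type*} [CommGroup G] [Group.FG G] {ι : Type*}
    [Finite ι] (W : ι → Set G)
    (hW : ∀ m, ∀ a ∈ W m, ∀ b ∈ W m, ∀ c ∈ W m, a * b⁻¹ * c ∈ W m) :
    ∃ M : ℕ, 0 < M ∧ ∀ N, M ∣ N →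
      (∃ γ : G, ∀ m, ∃ n : G, γ * n ^ N ∈ W m) → ∃ γ : G, ∀ m, γ ∈ W m := by
  by_cases hne : ∀ m, (W m).Nonempty
  swap
  · push Not at hne
    obtain ⟨m, hm⟩ := hne
    refine ⟨1, one_pos, fun N _ ⟨γ, h⟩ => ?_⟩
    obtain ⟨n, hn⟩ := h m
    simp [hm] at hn
  choose w hw using hne
  -- With `W m = H m * w m` for a subgroup `H m`, `D` is the product of the `H m` times the
  -- diagonal, and `w⁻¹ ∈ D` exactly when the cosets have a common point. Otherwise `w⁻¹` is
  -- separated from `D` in `ι → G`, where the separate `n m` form a single element.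
  let D : Subgroup (ι → G) :=
    { carrier := {v | ∃ γ : G, ∀ m, v m * γ * w m ∈ W m}
      one_mem' := ⟨1, fun m => by simpa using hw m⟩
      mul_mem' := by
        rintro a b ⟨γ, h⟩ ⟨δ, h'⟩
        refine ⟨γ * δ, fun m => ?_⟩
        have := hW m _ (h m) _ (hw m) _ (h' m)
        convert this using 1
        simp only [Pi.mul_apply]
        rw [mul_inv_cancel_right]
        simp only [mul_assoc, mul_left_comm]
      inv_mem' := by
        rintro a ⟨γ, h⟩
        refine ⟨γ⁻¹, fun m => ?_⟩
        have := hW m _ (hw m) _ (h m) _ (hw m)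
        convert this using 1
        simp only [Pi.inv_apply, mul_inv_rev]
        rw [mul_inv_cancel_left, mul_comm γ⁻¹] }
  by_cases hD : (fun m => (w m)⁻¹) ∈ D
  · obtain ⟨γ, h⟩ := hD
    exact ⟨1, one_pos, fun _ _ _ => ⟨γ, fun m => by simpa [mul_comm _ γ] using h m⟩⟩
  · have : Group.FG (ι → G) := by
      rw [Group.fg_def]
      have := Subgroup.FG.pi (ι := ι) (G := fun _ => G) (P := fun _ => ⊤)
        (fun _ => Group.fg_def.1 inferInstance)
      rwa [Subgroup.pi_top] at this
    obtain ⟨M, hM, h⟩ := CommGroup.exists_mul_pow_notMem D hD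
    refine ⟨M, hM, fun N hN ⟨γ, hγ⟩ => ?_⟩
    choose n hn using hγ
    refine (h N hN n ⟨γ, fun m => ?_⟩).elim
    convert hn m using 1
    simp only [Pi.mul_apply, Pi.pow_apply]
    rw [mul_comm _ (w m), mul_assoc, mul_inv_cancel_left, mul_comm]

/-! ### Structures as plain data -/

namespace UTuple

/-- A `𝔘`-structure on `X`, given by its relations. -/
structure Str (𝔘 : UTuple) (X : Type*) where
  E : 𝔘.S → X → X → Prop
  P : ∀ i, (Fin (𝔘.arity i) → X) → Prop
  symm : ∀ i, ∀ ϑ ∈ 𝔘.sym i, ∀ x, P i (fun j => x (ϑ j)) ↔ P i x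
  distinct : ∀ i x, P i x → Function.Injective x
  equiv : ∀ s, Equivalence (E s)
  nested : ∀ s t, s < t → ∀ x y, E s x y → E t x y
  exists_dist : Nonempty 𝔘.S → ∀ x y, x ≠ y → ∃ s, IsGreatest {t | ¬ E t x y} s

namespace Str

variable {𝔘 : UTuple} {X Y Z : Type*}

/-- Embeddings of `𝔘`-structures. -/
structure IsEmb (A : 𝔘.Str X) (B : 𝔘.Str Y) (f : X → Y) : Prop where
  inj : Function.Injective f
  E : ∀ s x y, B.E s (f x) (f y) ↔ A.E s x y
  P : ∀ i x, B.P i (fun j => f (x j)) ↔ A.P i x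

/-- The structure induced along an injective map. -/
def comap (B : 𝔘.Str Y) (f : X → Y) (hf : Function.Injective f) : 𝔘.Str X where
  E s x y := B.E s (f x) (f y)
  P i x := B.P i (fun j => f (x j))
  symm i ϑ hϑ x := B.symm i ϑ hϑ (fun j => f (x j))
  distinct i _ hx := (B.distinct i _ hx).of_comp
  equiv s := ⟨fun _ => (B.equiv s).refl _, (B.equiv s).symm, (B.equiv s).trans⟩
  nested s t h _ _ := B.nested s t h _ _
  exists_dist h _ _ hxy := B.exists_dist h _ _ (hf.ne hxy)

theorem isEmb_comap (B : 𝔘.Str Y) (f : X → Y) (hf : Function.Injective f) :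
    (B.comap f hf).IsEmb B f := ⟨hf, fun _ _ _ => Iff.rfl, fun _ _ => Iff.rfl⟩

theorem IsEmb.comp {A : 𝔘.Str X} {B : 𝔘.Str Y} {C : 𝔘.Str Z} {g : Y → Z} {f : X → Y}
    (hg : B.IsEmb C g) (hf : A.IsEmb B f) : A.IsEmb C (fun x => g (f x)) :=
  ⟨hg.inj.comp hf.inj, fun s x y => (hg.E s _ _).trans (hf.E s x y),
    fun i x => (hg.P i _).trans (hf.P i x)⟩

theorem IsEmb.of_comp {A : 𝔘.Str X} {B : 𝔘.Str Y} {C : 𝔘.Str Z} {g : Y → Z} {f : X → Y}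
    (hg : B.IsEmb C g) (hf : A.IsEmb C (fun x => g (f x))) : A.IsEmb B f :=
  ⟨Function.Injective.of_comp hf.inj, fun s x y => (hg.E s _ _).symm.trans (hf.E s x y),
    fun i x => (hg.P i _).symm.trans (hf.P i x)⟩

theorem isEmb_id (A : 𝔘.Str X) : A.IsEmb A (fun x => x) :=
  ⟨fun _ _ h => h, fun _ _ _ => Iff.rfl, fun _ _ => Iff.rfl⟩

/-- An action by automorphisms. -/
def IsAct {Γ : Type*} [Group Γ] (A : 𝔘.Str X) (α : Γ →* Equiv.Perm X) : Prop :=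
  ∀ γ, A.IsEmb A (α γ)

end Str
end UTuple

/-! ### Finite quotients of structures with a group action -/

/-- `R` describes an invariant equivalence relation on the free `Γ`-set `Γ × F`, where `R x γ y`
says that `(1, x)` is equivalent to `(γ, y)`. -/
structure IsGroupoidal {Γ F : Type*} [Group Γ] (R : F → Γ → F → Prop) : Prop where
  refl : ∀ x, R x 1 x
  symm : ∀ {x γ y}, R x γ y → R y γ⁻¹ x
  trans : ∀ {x γ y δ z}, R x γ y → R y δ z → R x (γ * δ) z

namespace IsGroupoidal

/-- The composition of `R` with the orbit relation of the subgroup of `N`-th powers. -/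
def powClosure {Γ F : Type*} [Group Γ] (R : F → Γ → F → Prop) (N : ℕ) (x : F) (γ : Γ) (y : F) :
    Prop := ∃ n : Γ, R x (γ * n ^ N) y

/-- The equivalence relation on `Γ × F` described by `R`. -/
def toSetoid {Γ F : Type*} [Group Γ] {R : F → Γ → F → Prop} (h : IsGroupoidal R) : Setoid (Γ × F) where
  r a b := R a.2 (a.1⁻¹ * b.1) b.2
  iseqv := ⟨fun a => by simpa using h.refl a.2, fun {a b} hab => by simpa using h.symm hab,
    fun {a b c} hab hbc => by simpa [mul_assoc] using h.trans hab hbc⟩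

variable {Γ F : Type*} [CommGroup Γ] {R : F → Γ → F → Prop}

theorem isGroupoidal_powClosure (h : IsGroupoidal R) (N : ℕ) : IsGroupoidal (powClosure R N) where
  refl x := ⟨1, by simpa using h.refl x⟩
  symm := by
    rintro x γ y ⟨n, hn⟩
    exact ⟨n⁻¹, by simpa [mul_comm] using h.symm hn⟩
  trans := by
    rintro x γ y δ z ⟨n, hn⟩ ⟨m, hm⟩
    exact ⟨n * m, by simpa [mul_pow, mul_mul_mul_comm] using h.trans hn hm⟩

/-- Thus `{γ | R x γ y}` is empty or a coset, the form required by
`CommGroup.exists_forall_mul_pow_mem_imp`. -/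
theorem mul_inv_mul (h : IsGroupoidal R) {x y : F} {a b c : Γ} (ha : R x a y) (hb : R x b y)
    (hc : R x c y) : R x (a * b⁻¹ * c) y := h.trans (h.trans ha (h.symm hb)) hc

/-- The `N`-th powers have finite index in `Γ`, and finitely many coset representatives times `F`
cover the quotient. -/
theorem finite_quotient (h : IsGroupoidal R) [Group.FG Γ] [Finite F] {N : ℕ} (hN : N ≠ 0) :
    Finite (Quotient (h.isGroupoidal_powClosure N).toSetoid) := by
  have := Subgroup.finiteIndex_range_powMonoidHom_of_fg Γ hN
  have : Finite (Γ ⧸ (powMonoidHom (α := Γ) N).range) := inferInstance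
  let q : (Γ ⧸ (powMonoidHom (α := Γ) N).range) × F →
      Quotient (h.isGroupoidal_powClosure N).toSetoid := fun p => Quotient.mk _ (p.1.out, p.2)
  refine Finite.of_surjective q fun d => ?_
  induction d using Quotient.inductionOn with | _ a => ?_
  refine ⟨(QuotientGroup.mk a.1, a.2), Quotient.sound ?_⟩
  obtain ⟨⟨_, n, rfl⟩, hn⟩ := QuotientGroup.mk_out_eq_mul (powMonoidHom (α := Γ) N).range a.1
  refine ⟨n, ?_⟩
  simp only [hn, powMonoidHom_apply]
  simpa using h.refl a.2

end IsGroupoidal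

/-! ### Rounding distances to a finite set -/

namespace UTuple

variable {𝔘 : UTuple} {Γ F : Type*}

/-- The relations `R s` rounded so that only distances in `T` occur. -/
def rounded (T : Finset 𝔘.S) (R0 : F → Γ → F → Prop) (R : 𝔘.S → F → Γ → F → Prop) (s : 𝔘.S)
    (x : F) (γ : Γ) (y : F) : Prop :=
  -- The clause `t < s` keeps points not related by `R0` at distance at least `min T`; the last
  -- clause makes the relation increasing in `s` even when `R` is not.
  R0 x γ y ∨ ((∃ t ∈ T, t < s) ∧ ∀ t ∈ T, s ≤ t → R t x γ y)

section

variable {T : Finset 𝔘.S} {R0 : F → Γ → F → Prop} {R : 𝔘.S → F → Γ → F → Prop}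

theorem isGroupoidal_rounded [Group Γ] (h0 : IsGroupoidal R0) (h : ∀ t, IsGroupoidal (R t))
    (h0R : ∀ t x γ y, R0 x γ y → R t x γ y) (s : 𝔘.S) : IsGroupoidal (rounded T R0 R s) where
  refl x := Or.inl (h0.refl x)
  symm := by
    rintro x γ y (hr | ⟨ht, hr⟩)
    · exact Or.inl (h0.symm hr)
    · exact Or.inr ⟨ht, fun t h1 h2 => (h t).symm (hr t h1 h2)⟩
  trans := by
    rintro x γ y δ z (hr | ⟨ht, hr⟩) (hr' | ⟨ht', hr'⟩)
    · exact Or.inl (h0.trans hr hr')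
    · exact Or.inr ⟨ht', fun t h1 h2 => (h t).trans (h0R t _ _ _ hr) (hr' t h1 h2)⟩
    · exact Or.inr ⟨ht, fun t h1 h2 => (h t).trans (hr t h1 h2) (h0R t _ _ _ hr')⟩
    · exact Or.inr ⟨ht, fun t h1 h2 => (h t).trans (hr t h1 h2) (hr' t h1 h2)⟩

theorem rounded_mono {s t : 𝔘.S} (hst : s < t) {x : F} {γ : Γ} {y : F}
    (h : rounded T R0 R s x γ y) : rounded T R0 R t x γ y := by
  obtain h | ⟨⟨u, hu, hus⟩, h⟩ := h
  · exact Or.inl h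
  · exact Or.inr ⟨⟨u, hu, hus.trans hst⟩, fun v hv htv => h v hv (hst.le.trans htv)⟩

theorem exists_isGreatest_not_rounded (hT : T.Nonempty)
    {x : F} {γ : Γ} {y : F} (h : ¬ R0 x γ y) : ∃ s, IsGreatest {t | ¬ rounded T R0 R t x γ y} s := by
  classical
  -- The distance is the largest `t ∈ T` at which `R t` fails, or `min T` if there is none.
  let T' := insert (T.min' hT) (T.filter fun t => ¬ R t x γ y)
  have hT' : T'.Nonempty := Finset.insert_nonempty _ _
  have hmem : T'.max' hT' ∈ T' := T'.max'_mem hT'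
  have hmin : ∀ t ∈ T, T.min' hT ≤ t := fun t ht => T.min'_le t ht
  refine ⟨T'.max' hT', ?_, fun s hs => ?_⟩
  · rintro (h' | ⟨⟨t, ht, hlt⟩, h'⟩)
    · exact h h'
    · rcases Finset.mem_insert.1 hmem with he | hm
      · exact absurd (hmin t ht) (not_le.2 (he ▸ hlt))
      · exact (Finset.mem_filter.1 hm).2 (h' _ (Finset.mem_filter.1 hm).1 le_rfl)
  · by_contra hlt
    push Not at hlt
    refine hs (Or.inr ⟨⟨_, T.min'_mem hT, lt_of_le_of_lt ?_ hlt⟩, fun t ht hst => ?_⟩)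
    · exact T'.le_max' _ (Finset.mem_insert_self _ _)
    · by_contra hn
      have : t ≤ T'.max' hT' :=
        T'.le_max' _ (Finset.mem_insert_of_mem (Finset.mem_filter.2 ⟨ht, hn⟩))
      exact absurd (lt_of_lt_of_le hlt hst) (not_lt.2 this)

end

end UTuple

/-! ### Quotient structures and their finite versions -/

namespace UTuple

variable {𝔘 : UTuple} {Γ : Type u} {F : Type v}

/-- The quotient structure on the `Γ`-set described by `R0`, with relations `R'` and with the
`Γ`-orbits of `Q` as tuples. -/
def quotStr [Group Γ] {R0 : F → Γ → F → Prop} (h0 : IsGroupoidal R0)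
    {R' : 𝔘.S → F → Γ → F → Prop} (h' : ∀ s, IsGroupoidal (R' s))
    (h0R : ∀ s x γ y, R0 x γ y → R' s x γ y)
    (hmono : ∀ s t, s < t → ∀ x γ y, R' s x γ y → R' t x γ y)
    (hdist : Nonempty 𝔘.S → ∀ x γ y, ¬ R0 x γ y → ∃ s, IsGreatest {t | ¬ R' t x γ y} s)
    (Q : ∀ i, (Fin (𝔘.arity i) → F) → Prop)
    (hQ : ∀ i, ∀ ϑ ∈ 𝔘.sym i, ∀ z, Q i z → Q i (fun j => z (ϑ j)))
    (hQinj : ∀ i z, Q i z → ∀ j k, R0 (z j) 1 (z k) → j = k) :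
    𝔘.Str (Quotient h0.toSetoid) where
  E s := Quotient.lift₂ (fun a b : Γ × F => R' s a.2 (a.1⁻¹ * b.1) b.2) (by
    rintro ⟨a, x⟩ ⟨b, y⟩ ⟨a', x'⟩ ⟨b', y'⟩ (h1 : R0 _ _ _) (h2 : R0 _ _ _)
    have h1' := h0R s _ _ _ h1
    have h2' := h0R s _ _ _ h2
    simp only at *
    refine propext ⟨fun h => ?_, fun h => ?_⟩
    · have := (h' s).trans ((h' s).trans ((h' s).symm h1') h) h2'
      simpa [mul_assoc] using this
    · have := (h' s).trans ((h' s).trans h1' h) ((h' s).symm h2')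
      simpa [mul_assoc] using this)
  P i d := ∃ (γ : Γ) (z : _), Q i z ∧ ∀ j, d j = Quotient.mk _ (γ, z j)
  symm i ϑ hϑ d := by
    constructor
    · rintro ⟨γ, z, hz, hd⟩
      refine ⟨γ, fun j => z (ϑ⁻¹ j), hQ i _ (inv_mem hϑ) z hz, fun j => ?_⟩
      simpa using hd (ϑ⁻¹ j)
    · rintro ⟨γ, z, hz, hd⟩
      exact ⟨γ, fun j => z (ϑ j), hQ i _ hϑ z hz, fun j => hd _⟩
  distinct := by
    rintro i d ⟨γ, z, hz, hd⟩ j k hjk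
    rw [hd, hd] at hjk
    have : R0 _ _ _ := Quotient.exact hjk
    exact hQinj i z hz j k (by simpa using this)
  equiv s := by
    refine ⟨fun a => ?_, fun {a b} => ?_, fun {a b c} => ?_⟩
    · induction a using Quotient.inductionOn
      simpa using (h' s).refl _
    · induction a, b using Quotient.inductionOn₂
      intro h
      simpa using (h' s).symm h
    · induction a, b, c using Quotient.inductionOn₃
      intro h1 h2
      simpa [mul_assoc] using (h' s).trans h1 h2
  nested s t hst a b := by
    induction a, b using Quotient.inductionOn₂
    exact hmono s t hst _ _ _
  exists_dist hS a b := by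
    induction a, b using Quotient.inductionOn₂
    intro hab
    exact hdist hS _ _ _ fun h => hab (Quotient.sound h)

/-- The translation action on the `Γ`-set described by `R0`. -/
def quotAct [Group Γ] {R0 : F → Γ → F → Prop} (h0 : IsGroupoidal R0) :
    Γ →* Equiv.Perm (Quotient h0.toSetoid) :=
  letI : MulAction Γ (Quotient h0.toSetoid) :=
    { smul := fun γ => Quotient.map (fun a => (γ * a.1, a.2)) (by
        rintro ⟨a, x⟩ ⟨b, y⟩ (h : R0 _ _ _)
        change R0 _ _ _
        simpa [mul_assoc] using h)
      one_smul := fun a => by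
        induction a using Quotient.inductionOn with | _ a => ?_
        exact congrArg (Quotient.mk _) (Prod.ext (one_mul _) rfl)
      mul_smul := fun γ δ a => by
        induction a using Quotient.inductionOn with | _ a => ?_
        exact congrArg (Quotient.mk _) (Prod.ext (mul_assoc _ _ _) rfl) }
  MulAction.toPermHom Γ _

theorem quotAct_mk [Group Γ] {R0 : F → Γ → F → Prop} (h0 : IsGroupoidal R0) (γ δ : Γ) (x : F) :
    quotAct h0 γ (Quotient.mk _ (δ, x)) = Quotient.mk _ (γ * δ, x) := rfl

theorem isAct_quotAct [Group Γ] {R0 : F → Γ → F → Prop} (h0 : IsGroupoidal R0)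
    {R' : 𝔘.S → F → Γ → F → Prop} (h' : ∀ s, IsGroupoidal (R' s))
    (h0R : ∀ s x γ y, R0 x γ y → R' s x γ y)
    (hmono : ∀ s t, s < t → ∀ x γ y, R' s x γ y → R' t x γ y)
    (hdist : Nonempty 𝔘.S → ∀ x γ y, ¬ R0 x γ y → ∃ s, IsGreatest {t | ¬ R' t x γ y} s)
    (Q : ∀ i, (Fin (𝔘.arity i) → F) → Prop)
    (hQ : ∀ i, ∀ ϑ ∈ 𝔘.sym i, ∀ z, Q i z → Q i (fun j => z (ϑ j)))
    (hQinj : ∀ i z, Q i z → ∀ j k, R0 (z j) 1 (z k) → j = k) :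
    (quotStr h0 h' h0R hmono hdist Q hQ hQinj).IsAct (quotAct h0) := by
  refine fun γ => ⟨(quotAct h0 γ).injective, fun s a b => ?_, fun i d => ?_⟩
  · induction a, b using Quotient.inductionOn₂ with | _ a b => ?_
    change R' s a.2 ((γ * a.1)⁻¹ * (γ * b.1)) b.2 ↔ R' s a.2 (a.1⁻¹ * b.1) b.2
    rw [mul_inv_rev, mul_assoc, inv_mul_cancel_left]
  · constructor
    · rintro ⟨δ, z, hz, hd⟩
      refine ⟨γ⁻¹ * δ, z, hz, fun j => ?_⟩
      rw [← quotAct_mk, ← hd, ← Equiv.Perm.mul_apply, ← map_mul]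
      simp
    · rintro ⟨δ, z, hz, hd⟩
      refine ⟨γ * δ, z, hz, fun j => ?_⟩
      rw [← quotAct_mk, ← hd]

/-- A finite set with a groupoidal system of relations maps faithfully to a finite structure with
an action of `Γ` by automorphisms. -/
theorem exists_finite_quotient [CommGroup Γ] [Group.FG Γ] [Finite F] (T : Finset 𝔘.S)
    (hT : Nonempty 𝔘.S → T.Nonempty) {R0 : F → Γ → F → Prop} {R : 𝔘.S → F → Γ → F → Prop}
    (h0 : IsGroupoidal R0) (h : ∀ t, IsGroupoidal (R t))
    (h0R : ∀ t x γ y, R0 x γ y → R t x γ y)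
    (Q : ∀ i, (Fin (𝔘.arity i) → F) → Prop)
    (hQ : ∀ i, ∀ ϑ ∈ 𝔘.sym i, ∀ z, Q i z → Q i (fun j => z (ϑ j)))
    (hQinj : ∀ i z, Q i z → ∀ j k, R0 (z j) 1 (z k) → j = k) :
    ∃ (D : Type (max u v)) (_ : Finite D) (𝒟 : 𝔘.Str D) (α : Γ →* Equiv.Perm D) (f : F → D),
      𝒟.IsAct α ∧ (∀ x y, f x = f y ↔ R0 x 1 y) ∧
      (∀ x γ y, R0 x γ y → α γ (f y) = f x) ∧
      (∀ s x y, 𝒟.E s (f x) (f y) ↔ rounded T R0 R s x 1 y) ∧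
      ∀ i (x : Fin (𝔘.arity i) → F), 𝒟.P i (fun j => f (x j)) ↔ ∃ γ z, Q i z ∧ ∀ j, R0 (x j) γ (z j) := by
  classical
  -- Separation is applied to the cosets `{1}` and `{γ | R1 x γ y}`: if the second contains an
  -- `N`-th power, it contains `1`.
  have key : ∀ R1 : F → Γ → F → Prop, IsGroupoidal R1 → ∀ x y, ∃ M : ℕ, 0 < M ∧ ∀ N, M ∣ N →
      IsGroupoidal.powClosure R1 N x 1 y → R1 x 1 y := by
    intro R1 h1 x y
    obtain ⟨M, hM, hs⟩ := CommGroup.exists_forall_mul_pow_mem_imp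
      (fun b : Bool => if b then ({1} : Set Γ) else {γ | R1 x γ y}) (by
        rintro (_ | _)
        · exact fun a ha b hb c hc => h1.mul_inv_mul ha hb hc
        · simp)
    refine ⟨M, hM, fun N hN ⟨n, hn⟩ => ?_⟩
    obtain ⟨γ, hγ⟩ := hs N hN ⟨1, by
      rintro (_ | _)
      · exact ⟨n, hn⟩
      · exact ⟨1, by simp⟩⟩
    have e : γ = 1 := hγ true
    have := hγ false
    simpa [e] using this
  choose! M0 hM0 hM0' using fun p : F × F => key R0 h0 p.1 p.2
  -- Finitely many exponents suffice here, since `rounded` only involves `R t` for `t ∈ T`.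
  choose! M1 hM1 hM1' using fun p : T × F × F => key (R p.1) (h p.1) p.2.1 p.2.2
  -- A tuple needs one `γ` serving all its coordinates, hence a simultaneous statement about several
  -- cosets.
  have key2 : ∀ p : Σ i, (Fin (𝔘.arity i) → F) × (Fin (𝔘.arity i) → F), ∃ M : ℕ, 0 < M ∧
      ∀ N, M ∣ N → (∃ γ, ∀ j, IsGroupoidal.powClosure R0 N (p.2.1 j) γ (p.2.2 j)) →
        ∃ γ, ∀ j, R0 (p.2.1 j) γ (p.2.2 j) := fun p =>
    CommGroup.exists_forall_mul_pow_mem_imp (fun j => {γ | R0 (p.2.1 j) γ (p.2.2 j)})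
      fun j a ha b hb c hc => h0.mul_inv_mul ha hb hc
  choose M2 hM2 hM2' using key2
  have := Fintype.ofFinite F
  let N := (∏ p, M0 p) * (∏ p, M1 p) * ∏ p, M2 p
  have hN : N ≠ 0 := by
    refine mul_ne_zero (mul_ne_zero ?_ ?_) ?_ <;> refine Finset.prod_ne_zero_iff.2 fun p _ => ?_
    exacts [(hM0 p).ne', (hM1 p).ne', (hM2 p).ne']
  have d0 : ∀ p, M0 p ∣ N := fun p =>
    ((Finset.dvd_prod_of_mem _ (Finset.mem_univ p)).mul_right _).mul_right _
  have d1 : ∀ p, M1 p ∣ N := fun p =>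
    ((Finset.dvd_prod_of_mem _ (Finset.mem_univ p)).mul_left _).mul_right _
  have d2 : ∀ p, M2 p ∣ N := fun p => (Finset.dvd_prod_of_mem _ (Finset.mem_univ p)).mul_left _
  have le0 : ∀ {R1 : F → Γ → F → Prop} {x γ y}, R1 x γ y → IsGroupoidal.powClosure R1 N x γ y :=
    fun h => ⟨1, by simpa using h⟩
  have e0 : ∀ x y, IsGroupoidal.powClosure R0 N x 1 y ↔ R0 x 1 y := fun x y =>
    ⟨hM0' (x, y) N (d0 _), le0⟩
  have e1 : ∀ t ∈ T, ∀ x y, IsGroupoidal.powClosure (R t) N x 1 y ↔ R t x 1 y := fun t ht x y =>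
    ⟨hM1' (⟨t, ht⟩, x, y) N (d1 _), le0⟩
  have g0 := h0.isGroupoidal_powClosure N
  have g1 := fun t => (h t).isGroupoidal_powClosure N
  have g01 : ∀ t x γ y, IsGroupoidal.powClosure R0 N x γ y →
      IsGroupoidal.powClosure (R t) N x γ y := fun t x γ y ⟨n, hn⟩ => ⟨n, h0R _ _ _ _ hn⟩
  let 𝒟 := quotStr g0 (fun s => isGroupoidal_rounded (T := T) g0 g1 g01 s)
    (fun s x γ y h => Or.inl h) (fun s t hst x γ y => rounded_mono hst)
    (fun hS x γ y h => exists_isGreatest_not_rounded (hT hS) h) Q hQ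
    (fun i z hz j k hjk => hQinj i z hz j k ((e0 _ _).1 hjk))
  refine ⟨_, h0.finite_quotient hN, 𝒟, quotAct g0, fun x => Quotient.mk _ (1, x),
    isAct_quotAct _ _ _ _ _ _ _ _, fun x y => ?_, fun x γ y hR => ?_, fun s x y => ?_,
    fun i x => ⟨?_, ?_⟩⟩
  · rw [Quotient.eq, ← e0]
    change IsGroupoidal.powClosure R0 N x (1⁻¹ * 1) y ↔ _
    simp
  · rw [quotAct_mk, Quotient.eq]
    change IsGroupoidal.powClosure R0 N y _ x
    simpa using le0 (h0.symm hR)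
  · change rounded T _ _ s x (1⁻¹ * 1) y ↔ _
    rw [inv_one, one_mul]
    refine or_congr (e0 _ _) (and_congr_right fun _ => forall₂_congr fun t ht => ?_)
    exact imp_congr_right fun _ => e1 t ht _ _
  · rintro ⟨γ, z, hz, hx⟩
    obtain ⟨δ, hδ⟩ := hM2' ⟨i, x, z⟩ N (d2 _) ⟨γ, fun j => by
      have : IsGroupoidal.powClosure R0 N _ _ _ := Quotient.exact (hx j)
      simpa using this⟩
    exact ⟨δ, z, hz, hδ⟩
  · rintro ⟨γ, z, hz, hx⟩
    refine ⟨γ, z, hz, fun j => Quotient.sound ?_⟩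
    change IsGroupoidal.powClosure R0 N _ _ _
    simpa using le0 (hx j)

end UTuple

/-! ### Finite approximation and equivariant amalgamation -/

namespace UTuple

variable {𝔘 : UTuple}

namespace Str

/-- All distances of `A` belong to the finite set `T`. -/
def DistIn {X : Type*} (A : 𝔘.Str X) (T : Finset 𝔘.S) : Prop :=
  Nonempty 𝔘.S → ∀ x y, x ≠ y → ∃ t ∈ T, IsGreatest {t | ¬ A.E t x y} t

theorem DistIn.mono {X : Type*} {A : 𝔘.Str X} {T T' : Finset 𝔘.S} (h : A.DistIn T) (hT : T ⊆ T') :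
    A.DistIn T' := fun hS x y hxy =>
  let ⟨t, ht, h'⟩ := h hS x y hxy
  ⟨t, hT ht, h'⟩

theorem exists_distIn {X : Type*} [Finite X] (A : 𝔘.Str X) : ∃ T, A.DistIn T := by
  classical
  have := Fintype.ofFinite X
  by_cases hS : Nonempty 𝔘.S
  · have s0 := hS.some
    have : ∀ p : X × X, ∃ t, p.1 ≠ p.2 → IsGreatest {t | ¬ A.E t p.1 p.2} t := fun p => by
      by_cases hp : p.1 = p.2
      · exact ⟨s0, fun h => (h hp).elim⟩
      · obtain ⟨t, ht⟩ := A.exists_dist hS _ _ hp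
        exact ⟨t, fun _ => ht⟩
    choose t ht using this
    exact ⟨Finset.univ.image t, fun _ x y hxy =>
      ⟨t (x, y), Finset.mem_image_of_mem _ (Finset.mem_univ _), ht (x, y) hxy⟩⟩
  · exact ⟨∅, fun h => (hS h).elim⟩

theorem exists_nonempty_superset (T : Finset 𝔘.S) :
    ∃ T' : Finset 𝔘.S, T ⊆ T' ∧ (Nonempty 𝔘.S → T'.Nonempty) := by
  classical
  by_cases hS : Nonempty 𝔘.S
  · exact ⟨insert hS.some T, Finset.subset_insert _ _, fun _ => Finset.insert_nonempty _ _⟩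
  · exact ⟨T, subset_rfl, fun h => (hS h).elim⟩

theorem E_mono {X : Type*} (A : 𝔘.Str X) {s t : 𝔘.S} (hst : s ≤ t) {x y : X} (h : A.E s x y) :
    A.E t x y := by
  rcases hst.eq_or_lt with rfl | hlt
  · exact h
  · exact A.nested s t hlt x y h

/-- The right-hand side has the shape of `rounded`, so rounding to `T` changes nothing on a
structure whose distances already lie in `T`. -/
theorem DistIn.E_iff {X : Type*} {A : 𝔘.Str X} {T : Finset 𝔘.S} (h : A.DistIn T) (s : 𝔘.S)
    (x y : X) : A.E s x y ↔ x = y ∨ ((∃ t ∈ T, t < s) ∧ ∀ t ∈ T, s ≤ t → A.E t x y) := by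
  by_cases hxy : x = y
  · subst hxy
    simp [(A.equiv s).refl x]
  obtain ⟨t, htT, ht, hmax⟩ := h ⟨s⟩ x y hxy
  simp only [hxy, false_or]
  constructor
  · intro hs
    refine ⟨⟨t, htT, ?_⟩, fun u _ hu => A.E_mono hu hs⟩
    by_contra hlt
    exact ht (A.E_mono (not_lt.1 hlt) hs)
  · rintro ⟨_, h2⟩
    by_contra hs
    exact ht (h2 t htT (hmax hs))

theorem IsAct.E_iff {X Γ : Type*} [Group Γ] {A : 𝔘.Str X} {α : Γ →* Equiv.Perm X} (h : A.IsAct α)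
    (t : 𝔘.S) (γ : Γ) (x y : X) : A.E t (α γ x) (α γ y) ↔ A.E t x y := (h γ).E t x y

/-- A finite part of an action on a structure embeds in an action on a finite structure. -/
theorem exists_finite_approx {X : Type*} {Γ : Type u} {F : Type v} [CommGroup Γ] [Group.FG Γ]
    [Finite F] (A : 𝔘.Str X) (α : Γ →* Equiv.Perm X) (hα : A.IsAct α) (j : F → X)
    (hj : Function.Injective j) :
    ∃ (D : Type (max u v)) (_ : Finite D) (𝒟 : 𝔘.Str D) (σ : Γ →* Equiv.Perm D) (f : F → D),
      𝒟.IsAct σ ∧ (A.comap j hj).IsEmb 𝒟 f ∧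
      ∀ x γ y, j x = α γ (j y) → σ γ (f y) = f x := by
  obtain ⟨T0, hT0⟩ := (A.comap j hj).exists_distIn
  obtain ⟨T, hT0T, hT⟩ := exists_nonempty_superset T0
  have g : ∀ E : X → X → Prop, Equivalence E → (∀ γ x y, E (α γ x) (α γ y) ↔ E x y) →
      IsGroupoidal (fun (x : F) (γ : Γ) (y : F) => E (j x) (α γ (j y))) := by
    intro E hE hEα
    refine ⟨fun x => by simpa using hE.refl _, fun {x γ y} h => ?_, fun {x γ y δ z} h h' => ?_⟩
    · refine hE.symm ?_
      rw [← hEα γ]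
      simpa using h
    · rw [map_mul, Equiv.Perm.mul_apply]
      exact hE.trans h ((hEα γ _ _).2 h')
  -- The data describe the `Γ`-saturation of `F` inside `X`, whose finite quotient is faithful on
  -- `F`.
  obtain ⟨D, hD, 𝒟, σ, f, h1, h2, h3, h4, h5⟩ := exists_finite_quotient (𝔘 := 𝔘) (Γ := Γ) (F := F)
    T hT (R0 := fun x γ y => j x = α γ (j y)) (R := fun t x γ y => A.E t (j x) (α γ (j y)))
    (g _ ⟨fun _ => rfl, Eq.symm, Eq.trans⟩ fun γ x y => (α γ).injective.eq_iff)
    (fun t => g _ (A.equiv t) (hα.E_iff t)) (fun t x γ y h => h ▸ (A.equiv t).refl _)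
    (fun i z => A.P i (fun k => j (z k))) (fun i ϑ hϑ z => (A.symm i ϑ hϑ (fun k => j (z k))).2)
    (fun i z hz k l hkl => A.distinct i _ hz (by simpa using hkl))
  refine ⟨D, hD, 𝒟, σ, f, h1, ⟨fun x y hxy => hj (by simpa using (h2 x y).1 hxy),
    fun s x y => ?_, fun i x => ?_⟩, h3⟩
  · rw [h4, (hT0.mono hT0T).E_iff s x y]
    simp [rounded, comap, hj.eq_iff]
  · rw [h5]
    constructor
    · rintro ⟨γ, z, hz, hx⟩
      change A.P i _
      simp only [hx]
      exact ((hα γ).P i _).2 hz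
    · exact fun h => ⟨1, x, h, fun k => by simp⟩

end Str

section Amalgam

variable {Γ Δ B C A : Type*} [Group Γ] [Group Δ] (φ : Δ →* Γ) (β : Γ →* Equiv.Perm B)
  (κ : Δ →* Equiv.Perm C) (iB : A → B) (iC : A → C) (EB : B → B → Prop) (EC : C → C → Prop)

/-- The equivalence relation on the free amalgam over `A` of `B` and the `Γ`-set induced by `C`. -/
def amalgRel : B ⊕ C → Γ → B ⊕ C → Prop
  | .inl b, γ, .inl b' => EB b (β γ b')
  | .inl b, γ, .inr c => ∃ a, EB b (β γ (iB a)) ∧ EC (iC a) c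
  | .inr c, γ, .inl b => ∃ a, EC c (iC a) ∧ EB (iB a) (β γ b)
  -- Either `c` and the `γ`-translate of `c'` lie in the same translate of `C`, or they are joined
  -- through points of `A` seen in `B`.
  | .inr c, γ, .inr c' => (∃ δ, φ δ = γ ∧ EC c (κ δ c')) ∨
      ∃ a a', EC c (iC a) ∧ EB (iB a) (β γ (iB a')) ∧ EC (iC a') c'

variable {φ β κ iB iC EB EC}

/-- In a composite chain, two consecutive passages through `A` are merged by `hA`, and a translation
by `δ` inside `C` is absorbed into the point of `A` by `hαB` and `hαC`. -/
theorem isGroupoidal_amalgRel {α : Δ → A → A}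
    (hB : Equivalence EB) (hC : Equivalence EC) (hβ : ∀ γ x y, EB (β γ x) (β γ y) ↔ EB x y)
    (hκ : ∀ δ x y, EC (κ δ x) (κ δ y) ↔ EC x y) (hA : ∀ a a', EB (iB a) (iB a') ↔ EC (iC a) (iC a'))
    (hαB : ∀ δ a, iB (α δ a) = β (φ δ) (iB a)) (hαC : ∀ δ a, iC (α δ a) = κ δ (iC a)) :
    IsGroupoidal (amalgRel φ β κ iB iC EB EC) := by
  have sB : ∀ {γ x y}, EB x (β γ y) → EB y (β γ⁻¹ x) := fun {γ x y} h => by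
    have := (hβ γ⁻¹ _ _).2 (hB.symm h)
    simpa using this
  have tB : ∀ {γ δ x y z}, EB x (β γ y) → EB y (β δ z) → EB x (β (γ * δ) z) :=
    fun {γ δ x y z} h h' => by
      have := hB.trans h ((hβ γ _ _).2 h')
      simpa using this
  have sC : ∀ {δ x y}, EC x (κ δ y) → EC y (κ δ⁻¹ x) := fun {γ x y} h => by
    have := (hκ γ⁻¹ _ _).2 (hC.symm h)
    simpa using this
  have tC : ∀ {γ δ x y z}, EC x (κ γ y) → EC y (κ δ z) → EC x (κ (γ * δ) z) :=
    fun {γ δ x y z} h h' => by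
      have := hC.trans h ((hκ γ _ _).2 h')
      simpa using this
  have mid : ∀ {γ δ x a a' z}, EB x (β γ (iB a)) → EC (iC a) (iC a') → EB (iB a') (β δ z) →
      EB x (β (γ * δ) z) := fun {γ δ x a a' z} h h' h'' => tB h (hB.trans ((hA _ _).2 h') h'')
  constructor
  · rintro (b | c)
    · simpa [amalgRel] using hB.refl b
    · exact Or.inl ⟨1, map_one φ, by simpa using hC.refl c⟩
  · rintro (b | c) γ (b' | c') h
    · exact sB h
    · obtain ⟨a, h1, h2⟩ := h
      exact ⟨a, hC.symm h2, sB h1⟩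
    · obtain ⟨a, h1, h2⟩ := h
      exact ⟨a, sB h2, hC.symm h1⟩
    · rcases h with ⟨δ, rfl, h⟩ | ⟨a, a', h1, h2, h3⟩
      · exact Or.inl ⟨δ⁻¹, map_inv φ δ, sC h⟩
      · exact Or.inr ⟨a', a, hC.symm h3, sB h2, hC.symm h1⟩
  · rintro (b | c) γ (b' | c') δ (b'' | c'') h h'
    · exact tB h h'
    · obtain ⟨a, h1, h2⟩ := h'
      exact ⟨a, tB h h1, h2⟩
    · obtain ⟨a, h1, h2⟩ := h
      obtain ⟨a', h3, h4⟩ := h'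
      exact mid h1 (hC.trans h2 h3) h4
    · obtain ⟨a, h1, h2⟩ := h
      rcases h' with ⟨δ, rfl, h'⟩ | ⟨a1, a2, h3, h4, h5⟩
      · refine ⟨α δ⁻¹ a, ?_, ?_⟩
        · rw [hαB, ← Equiv.Perm.mul_apply, ← map_mul, mul_assoc, ← map_mul]
          simpa using h1
        · rw [hαC, ← hκ δ]
          simpa using hC.trans h2 h'
      · exact ⟨a2, mid h1 (hC.trans h2 h3) h4, h5⟩
    · obtain ⟨a, h1, h2⟩ := h
      exact ⟨a, h1, tB h2 h'⟩
    · obtain ⟨a, h1, h2⟩ := h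
      obtain ⟨a', h3, h4⟩ := h'
      exact Or.inr ⟨a, a', h1, tB h2 h3, h4⟩
    · obtain ⟨a', h3, h4⟩ := h'
      rcases h with ⟨δ, rfl, h⟩ | ⟨a1, a2, h5, h6, h7⟩
      · refine ⟨α δ a', ?_, ?_⟩
        · rw [hαC]
          exact hC.trans h ((hκ _ _ _).2 h3)
        · rw [hαB, map_mul]
          exact (hβ _ _ _).2 h4
      · exact ⟨a1, h5, mid h6 (hC.trans h7 h3) h4⟩
    · rcases h with ⟨δ, rfl, h⟩ | ⟨a1, a2, h5, h6, h7⟩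
      · rcases h' with ⟨ε, rfl, h'⟩ | ⟨a3, a4, h1, h2, h3⟩
        · exact Or.inl ⟨δ * ε, map_mul φ _ _, tC h h'⟩
        · refine Or.inr ⟨α δ a3, a4, ?_, ?_, h3⟩
          · rw [hαC]
            exact hC.trans h ((hκ _ _ _).2 h1)
          · rw [hαB, map_mul]
            exact (hβ _ _ _).2 h2
      · rcases h' with ⟨ε, rfl, h'⟩ | ⟨a3, a4, h1, h2, h3⟩
        · refine Or.inr ⟨a1, α ε⁻¹ a2, h5, ?_, ?_⟩
          · rw [hαB, ← Equiv.Perm.mul_apply, ← map_mul, mul_assoc, ← map_mul]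
            simpa using h6
          · rw [hαC, ← hκ ε]
            simpa using hC.trans h7 h'
        · exact Or.inr ⟨a1, a4, h5, mid h6 (hC.trans h7 h1) h2, h3⟩

/-- Injectivity of `φ` prevents a nontrivial `δ` from acting as `1`, and paths through `A` add
nothing because `A` carries the same relation in `B` and in `C`. -/
theorem amalgRel_inr_inr_one (hφ : Function.Injective φ) (hC : Equivalence EC)
    (hA : ∀ a a', EB (iB a) (iB a') ↔ EC (iC a) (iC a')) (c c' : C) :
    amalgRel φ β κ iB iC EB EC (.inr c) 1 (.inr c') ↔ EC c c' := by
  constructor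
  · rintro (⟨δ, hδ, h⟩ | ⟨a, a', h1, h2, h3⟩)
    · obtain rfl : δ = 1 := hφ (hδ.trans (map_one φ).symm)
      simpa using h
    · exact hC.trans h1 (hC.trans ((hA _ _).1 (by simpa using h2)) h3)
  · exact fun h => Or.inl ⟨1, map_one φ, by simpa using h⟩

end Amalgam

/-- Amalgamation over `A` of a finite structure `B` with an action of `Γ` and a finite
structure `C` with an action of a subgroup `Δ`. -/
theorem exists_equivariant_amalgam {Γ : Type u} [CommGroup Γ] [Group.FG Γ] {Δ : Type*} [Group Δ]
    (φ : Δ →* Γ) (hφ : Function.Injective φ) {A : Type*} {B C : Type v} [Finite B] [Finite C]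
    {𝒜 : 𝔘.Str A} {ℬ : 𝔘.Str B} {𝒞 : 𝔘.Str C} {α : Δ → A → A} {β : Γ →* Equiv.Perm B}
    {κ : Δ →* Equiv.Perm C} (hβ : ℬ.IsAct β) (hκ : 𝒞.IsAct κ) {iB : A → B} {iC : A → C}
    (hiB : 𝒜.IsEmb ℬ iB) (hiC : 𝒜.IsEmb 𝒞 iC)
    (hαB : ∀ δ a, iB (α δ a) = β (φ δ) (iB a)) (hαC : ∀ δ a, iC (α δ a) = κ δ (iC a)) :
    ∃ (D : Type (max u v)) (_ : Finite D) (𝒟 : 𝔘.Str D) (σ : Γ →* Equiv.Perm D) (fB : B → D)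
      (fC : C → D), 𝒟.IsAct σ ∧ ℬ.IsEmb 𝒟 fB ∧ 𝒞.IsEmb 𝒟 fC ∧
      (∀ a, fB (iB a) = fC (iC a)) ∧ (∀ γ b, fB (β γ b) = σ γ (fB b)) ∧
      ∀ δ c, fC (κ δ c) = σ (φ δ) (fC c) := by
  classical
  obtain ⟨TB, hTB⟩ := ℬ.exists_distIn
  obtain ⟨TC, hTC⟩ := 𝒞.exists_distIn
  obtain ⟨T, hTT, hT⟩ := Str.exists_nonempty_superset (TB ∪ TC)
  replace hTB := hTB.mono (Finset.union_subset_left hTT)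
  replace hTC := hTC.mono (Finset.union_subset_right hTT)
  have hAeq : ∀ a a', iB a = iB a' ↔ iC a = iC a' := fun a a' => by
    rw [hiB.inj.eq_iff, hiC.inj.eq_iff]
  have hAE : ∀ t a a', ℬ.E t (iB a) (iB a') ↔ 𝒞.E t (iC a) (iC a') := fun t a a' => by
    rw [hiB.E, hiC.E]
  have heq := fun c c' => amalgRel_inr_inr_one (β := β) (κ := κ) hφ
    (⟨fun _ => rfl, Eq.symm, Eq.trans⟩ : Equivalence (fun c c' : C => c = c')) hAeq c c'
  have heqE := fun t c c' => amalgRel_inr_inr_one (β := β) (κ := κ) hφ (𝒞.equiv t) (hAE t) c c'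
  obtain ⟨D, hD, 𝒟, σ, f, h1, h2, h3, h4, h5⟩ := exists_finite_quotient (𝔘 := 𝔘) (Γ := Γ)
    (F := B ⊕ C) T hT (R0 := amalgRel φ β κ iB iC (fun b b' => b = b') (fun c c' => c = c'))
    (R := fun t => amalgRel φ β κ iB iC (ℬ.E t) (𝒞.E t))
    (isGroupoidal_amalgRel ⟨fun _ => rfl, Eq.symm, Eq.trans⟩ ⟨fun _ => rfl, Eq.symm, Eq.trans⟩
      (fun γ x y => (β γ).injective.eq_iff) (fun γ x y => (κ γ).injective.eq_iff) hAeq hαB hαC)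
    (fun t => isGroupoidal_amalgRel (ℬ.equiv t) (𝒞.equiv t) (hβ.E_iff t) (hκ.E_iff t) (hAE t)
      hαB hαC)
    (by
      have eB : ∀ t {b b'}, b = b' → ℬ.E t b b' := fun t b b' h => h ▸ (ℬ.equiv t).refl _
      have eC : ∀ t {b b'}, b = b' → 𝒞.E t b b' := fun t b b' h => h ▸ (𝒞.equiv t).refl _
      rintro t (b | c) γ (b' | c') h
      · exact eB t h
      · obtain ⟨a, h1, h2⟩ := h
        exact ⟨a, eB t h1, eC t h2⟩
      · obtain ⟨a, h1, h2⟩ := h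
        exact ⟨a, eC t h1, eB t h2⟩
      · rcases h with ⟨δ, hδ, h⟩ | ⟨a, a', h1, h2, h3⟩
        · exact Or.inl ⟨δ, hδ, eC t h⟩
        · exact Or.inr ⟨a, a', eC t h1, eB t h2, eC t h3⟩)
    -- The amalgam is free: the only `P`-tuples are translates of those of `B` and of `C`.
    (fun i z => (∃ zb, (∀ j, z j = .inl (zb j)) ∧ ℬ.P i zb) ∨
      ∃ zc, (∀ j, z j = .inr (zc j)) ∧ 𝒞.P i zc)
    (by
      rintro i ϑ hϑ z (⟨zb, hz, h⟩ | ⟨zc, hz, h⟩)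
      · exact Or.inl ⟨_, fun j => hz _, (ℬ.symm i ϑ hϑ zb).2 h⟩
      · exact Or.inr ⟨_, fun j => hz _, (𝒞.symm i ϑ hϑ zc).2 h⟩)
    (by
      rintro i z (⟨zb, hz, h⟩ | ⟨zc, hz, h⟩) j k hjk
      · rw [hz, hz] at hjk
        exact ℬ.distinct i zb h (by simpa [amalgRel] using hjk)
      · rw [hz, hz, heq] at hjk
        exact 𝒞.distinct i zc h hjk)
  refine ⟨D, hD, 𝒟, σ, fun b => f (.inl b), fun c => f (.inr c), h1,
    ⟨fun x y hxy => ?_, fun s x y => ?_, fun i x => ?_⟩,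
    ⟨fun x y hxy => ?_, fun s x y => ?_, fun i x => ?_⟩, fun a => ?_, fun γ b => ?_, fun δ c => ?_⟩
  · simpa [amalgRel] using (h2 _ _).1 hxy
  · rw [h4, hTB.E_iff s x y]
    simp [rounded, amalgRel]
  · rw [h5]
    constructor
    · rintro ⟨γ, z, ⟨zb, hz, h⟩ | ⟨zc, hz, h⟩, hx⟩
      · have : x = fun j => β γ (zb j) := funext fun j => by
          have := hx j
          rwa [hz] at this
        rw [this]
        exact ((hβ γ).P i _).2 h
      -- A tuple of `B` that lies in a translate of `C` comes from `A`, where the two structures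
      -- agree.
      · have : ∀ j, ∃ a, x j = β γ (iB a) ∧ iC a = zc j := fun j => by
          have := hx j
          rwa [hz] at this
        choose a ha ha' using this
        rw [funext ha]
        refine ((hβ γ).P i _).2 ((hiB.P i _).2 ((hiC.P i _).1 ?_))
        rwa [funext ha']
    · exact fun h => ⟨1, _, Or.inl ⟨x, fun _ => rfl, h⟩, fun j => by simp [amalgRel]⟩
  · exact (heq _ _).1 ((h2 _ _).1 hxy)
  · rw [h4, hTC.E_iff s x y, rounded, heq]
    simp only [heqE]
  · rw [h5]
    constructor
    · rintro ⟨γ, z, ⟨zb, hz, h⟩ | ⟨zc, hz, h⟩, hx⟩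
      · have : ∀ j, ∃ a, x j = iC a ∧ iB a = β γ (zb j) := fun j => by
          have := hx j
          rwa [hz] at this
        choose a ha ha' using this
        rw [funext ha]
        refine (hiC.P i _).2 ((hiB.P i _).1 ?_)
        rw [funext ha']
        exact ((hβ γ).P i _).2 h
      · have hx' : ∀ j, (∃ δ, φ δ = γ ∧ x j = κ δ (zc j)) ∨
            ∃ a a', x j = iC a ∧ iB a = β γ (iB a') ∧ iC a' = zc j := fun j => by
          have := hx j
          rwa [hz] at this
        -- If `γ` comes from `Δ`, the translate is `C` itself; otherwise it meets `C` only in points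
        -- coming from `A`.
        by_cases hγ : ∃ δ, φ δ = γ
        · obtain ⟨δ, rfl⟩ := hγ
          have : x = fun j => κ δ (zc j) := funext fun j => by
            rcases hx' j with ⟨ε, hε, he⟩ | ⟨a, a', e1, e2, e3⟩
            · rwa [hφ hε] at he
            · rw [← hαB] at e2
              rw [e1, hiB.inj e2, hαC, e3]
          rw [this]
          exact ((hκ δ).P i _).2 h
        · have : ∀ j, ∃ a a', x j = iC a ∧ iB a = β γ (iB a') ∧ iC a' = zc j := fun j =>
            (hx' j).resolve_left fun ⟨δ, hδ, _⟩ => hγ ⟨δ, hδ⟩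
          choose a a' e1 e2 e3 using this
          rw [funext e1]
          refine (hiC.P i _).2 ((hiB.P i _).1 ?_)
          rw [funext e2]
          refine ((hβ γ).P i _).2 ((hiB.P i _).2 ((hiC.P i _).1 ?_))
          rwa [funext e3]
    · exact fun h => ⟨1, _, Or.inr ⟨x, fun _ => rfl, h⟩, fun j => (heq _ _).2 rfl⟩
  · exact (h2 _ _).2 ⟨a, by simp, rfl⟩
  · exact (h3 (.inl (β γ b)) γ (.inl b) rfl).symm
  · exact (h3 (.inr (κ δ c)) (φ δ) (.inr c) (Or.inl ⟨δ, rfl, rfl⟩)).symm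

end UTuple

/-! ### Structures as plain data and first-order structures -/

namespace UTuple

open FirstOrder FirstOrder.Language

variable {𝔘 : UTuple}

instance : 𝔘.lang.IsRelational := fun _ => inferInstanceAs (IsEmpty Empty)

theorem relMap_E {M : Type*} [𝔘.lang.Structure M] (s : 𝔘.S) (x : Fin 2 → M) :
    Structure.RelMap (L := 𝔘.lang) (Symb.E s : 𝔘.lang.Relations 2) x ↔ 𝔘.relE s (x 0) (x 1) := by
  rw [relE, ← List.ofFn_inj.1 (by simp : List.ofFn x = List.ofFn ![x 0, x 1])]

/-- Maps preserving all relations are embeddings. -/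
def embeddingOfRel {M N : Type*} [𝔘.lang.Structure M] [𝔘.lang.Structure N] (f : M → N)
    (hf : Function.Injective f) (hE : ∀ s x y, 𝔘.relE s (f x) (f y) ↔ 𝔘.relE s x y)
    (hP : ∀ i x, 𝔘.relP i (fun j => f (x j)) ↔ 𝔘.relP i x) : M ↪[𝔘.lang] N where
  toFun := f
  inj' := hf
  map_fun' g := g.elim
  map_rel' r x := by
    cases r with
    | E s => rw [relMap_E, relMap_E]; exact hE s _ _
    | P i => exact hP i x

theorem relE_embedding {M N : Type*} [𝔘.lang.Structure M] [𝔘.lang.Structure N]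
    (f : M ↪[𝔘.lang] N) (s : 𝔘.S) (x y : M) : 𝔘.relE s (f x) (f y) ↔ 𝔘.relE s x y := by
  have := f.map_rel (Symb.E s : 𝔘.lang.Relations 2) ![x, y]
  rwa [relMap_E, relMap_E] at this

theorem relP_embedding {M N : Type*} [𝔘.lang.Structure M] [𝔘.lang.Structure N]
    (f : M ↪[𝔘.lang] N) (i : Fin 𝔘.r) (x : Fin (𝔘.arity i) → M) :
    𝔘.relP i (fun j => f (x j)) ↔ 𝔘.relP i x :=
  f.map_rel (Symb.P i : 𝔘.lang.Relations (𝔘.arity i)) x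

/-- The first-order structure with the relations of `A`. -/
@[reducible] def Str.toStructure {X : Type*} (A : 𝔘.Str X) : 𝔘.lang.Structure X where
  funMap f := Empty.elim f
  RelMap {n} (r : 𝔘.Symb n) := match n, r with
    | _, .E s => fun x => A.E s (x 0) (x 1)
    | _, .P i => A.P i

theorem Str.isUStructure {X : Type*} (A : 𝔘.Str X) :
    letI := A.toStructure
    𝔘.IsUStructure X :=
  letI := A.toStructure
  ⟨A.symm, A.distinct, A.equiv, A.nested, fun h => A.exists_dist h.to_subtype⟩

/-- The relations of a `𝔘`-structure. -/
def IsUStructure.str {M : Type*} [𝔘.lang.Structure M] (h : 𝔘.IsUStructure M) : 𝔘.Str M where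
  E := 𝔘.relE
  P := 𝔘.relP
  symm := h.symm
  distinct := h.distinct
  equiv := h.equiv
  nested := h.nested
  exists_dist hS := h.exists_dist (Set.nonempty_coe_sort.1 hS)

/-- A set, as a substructure. -/
def substructure {M : Type*} [𝔘.lang.Structure M] (F : Set M) : 𝔘.lang.Substructure M where
  carrier := F
  fun_mem f := f.elim

@[simp]
theorem mem_substructure {M : Type*} [𝔘.lang.Structure M] {F : Set M} {x : M} :
    x ∈ substructure (𝔘 := 𝔘) F ↔ x ∈ F := Iff.rfl

namespace IsRandomisedUltrametricSpace

variable {U : Type w} [𝔘.lang.Structure U] [Countable U]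

theorem isUStructure_of_finite (hU : 𝔘.IsRandomisedUltrametricSpace U) (F : Set U)
    [Finite F] : 𝔘.IsUStructure (substructure (𝔘 := 𝔘) F) := by
  have : Finite (substructure (𝔘 := 𝔘) F) := ‹Finite F›
  have h : CategoryTheory.Bundled.of (c := 𝔘.lang.Structure) (substructure (𝔘 := 𝔘) F) ∈ 𝔘.lang.age U :=
    ⟨(substructure (𝔘 := 𝔘) F).fg_iff_structure_fg.1 Substructure.FG.of_finite,
      ⟨(substructure (𝔘 := 𝔘) F).subtype⟩⟩
  rw [hU.age] at h
  exact h.2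

/-- Each axiom concerns finitely many points, so it can be checked in a finite substructure. -/
theorem isUStructure (hU : 𝔘.IsRandomisedUltrametricSpace U) : 𝔘.IsUStructure U := by
  have hE : ∀ (F : Set U) (s : 𝔘.S) (x y : substructure (𝔘 := 𝔘) F),
      𝔘.relE s (x : U) (y : U) ↔ 𝔘.relE s x y := fun F s x y =>
    relE_embedding (substructure (𝔘 := 𝔘) F).subtype s x y
  have hP : ∀ (F : Set U) (i : Fin 𝔘.r) (x : Fin (𝔘.arity i) → substructure (𝔘 := 𝔘) F),
      𝔘.relP i (fun j => (x j : U)) ↔ 𝔘.relP i x := fun F i x =>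
    relP_embedding (substructure (𝔘 := 𝔘) F).subtype i x
  refine ⟨fun i ϑ hϑ x => ?_, fun i x hx => ?_, fun s => ⟨fun x => ?_, fun {x y} => ?_,
    fun {x y z} => ?_⟩, fun s t hst x y => ?_, fun hS x y hxy => ?_⟩
  · have := (hU.isUStructure_of_finite (Set.range x)).symm i ϑ hϑ (fun j => ⟨x j, j, rfl⟩)
    rwa [← hP, ← hP] at this
  · have := (hU.isUStructure_of_finite (Set.range x)).distinct i (fun j => ⟨x j, j, rfl⟩)
      ((hP _ _ _).1 hx)
    exact fun j k hjk => this (Subtype.ext hjk)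
  · exact (hE {x} s ⟨x, rfl⟩ ⟨x, rfl⟩).2
      (((hU.isUStructure_of_finite {x}).equiv s).refl _)
  · have := ((hU.isUStructure_of_finite {x, y}).equiv s).symm
      (x := ⟨x, by simp⟩) (y := ⟨y, by simp⟩)
    rwa [← hE, ← hE] at this
  · have := ((hU.isUStructure_of_finite {x, y, z}).equiv s).trans
      (x := ⟨x, by simp⟩) (y := ⟨y, by simp⟩)
      (z := ⟨z, by simp⟩)
    rwa [← hE, ← hE, ← hE] at this
  · have := (hU.isUStructure_of_finite {x, y}).nested s t hst
      ⟨x, by simp⟩ ⟨y, by simp⟩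
    rwa [← hE, ← hE] at this
  · have := (hU.isUStructure_of_finite {x, y}).exists_dist hS
      ⟨x, by simp⟩ ⟨y, by simp⟩ (fun h => hxy (congrArg Subtype.val h))
    simp only [← hE] at this
    exact this

/-- The relations of `U`. -/
abbrev str (hU : 𝔘.IsRandomisedUltrametricSpace U) : 𝔘.Str U := hU.isUStructure.str

theorem isEmb_aut (hU : 𝔘.IsRandomisedUltrametricSpace U) (g : AutGroup 𝔘.lang U) :
    hU.str.IsEmb hU.str g :=
  let e := FirstOrder.Language.Equiv.toEmbedding (show U ≃[𝔘.lang] U from g)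
  ⟨EquivLike.injective g, fun s x y => relE_embedding e s x y, fun i x => relP_embedding e i x⟩

/-- Two embeddings of a finite structure differ by an automorphism. -/
theorem exists_aut (hU : 𝔘.IsRandomisedUltrametricSpace U) {A : Type*} [Finite A] {𝒜 : 𝔘.Str A}
    {f g : A → U} (hf : 𝒜.IsEmb hU.str f) (hg : 𝒜.IsEmb hU.str g) :
    ∃ h : AutGroup 𝔘.lang U, ∀ a, h (f a) = g a := by
  let e := Equiv.ofInjective f hf.inj
  have he : ∀ x : Set.range f, f (e.symm x) = x := fun x => congrArg Subtype.val (e.apply_symm_apply x)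
  have hE : ∀ (s : 𝔘.S) (x y : substructure (𝔘 := 𝔘) (Set.range f)),
      𝔘.relE s (x : U) (y : U) ↔ 𝔘.relE s x y := fun s x y =>
    relE_embedding (substructure (𝔘 := 𝔘) _).subtype s x y
  have hP : ∀ (i : Fin 𝔘.r) (x : Fin (𝔘.arity i) → substructure (𝔘 := 𝔘) (Set.range f)),
      𝔘.relP i (fun j => (x j : U)) ↔ 𝔘.relP i x := fun i x =>
    relP_embedding (substructure (𝔘 := 𝔘) _).subtype i x
  have hs : ∀ x : substructure (𝔘 := 𝔘) (Set.range f), f (e.symm x) = x := he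
  have : Finite (substructure (𝔘 := 𝔘) (Set.range f)) := inferInstanceAs (Finite (Set.range f))
  obtain ⟨h, hh⟩ := hU.ultrahomogeneous (substructure (Set.range f)) Substructure.FG.of_finite
    (embeddingOfRel (fun x => g (e.symm x)) (hg.inj.comp e.symm.injective)
      (fun s x y => by
        rw [← hE, ← hs x, ← hs y]
        simp only [hs]
        exact (hg.E s _ _).trans ((hf.E s _ _).symm.trans (by rw [hs, hs]; rfl)))
      (fun i x => by
        rw [← hP]
        refine (hg.P i fun j => e.symm (x j)).trans ((hf.P i _).symm.trans ?_)
        simp only [hs]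
        rfl))
  refine ⟨h, fun a => ?_⟩
  have := DFunLike.congr_fun hh ⟨f a, a, rfl⟩
  refine Eq.trans this.symm ?_
  change g (e.symm (e a)) = g a
  rw [e.symm_apply_apply]

/-- Every finite structure embeds, with prescribed values on a substructure. -/
theorem exists_emb (hU : 𝔘.IsRandomisedUltrametricSpace U) {A D : Type*} [Finite D] {𝒜 : 𝔘.Str A}
    {𝒟 : 𝔘.Str D} {b : A → D} {a : A → U} (hb : 𝒜.IsEmb 𝒟 b) (ha : 𝒜.IsEmb hU.str a) :
    ∃ k : D → U, 𝒟.IsEmb hU.str k ∧ ∀ x, k (b x) = a x := by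
  have : Finite A := Finite.of_injective b hb.inj
  obtain ⟨n, ⟨e⟩⟩ := Finite.exists_equiv_fin D
  -- The age of `U` consists of structures in the universe of `U`, so `D` is replaced by a copy
  -- living there.
  let e' : ULift.{w} (Fin n) → D := fun i => e.symm i.down
  have he' : Function.Injective e' := e.symm.injective.comp ULift.down_injective
  let 𝒟' := 𝒟.comap e' he'
  let _ := 𝒟'.toStructure
  have : CategoryTheory.Bundled.of (c := 𝔘.lang.Structure) (ULift.{w} (Fin n)) ∈ 𝔘.lang.age U := by
    rw [hU.age]
    exact ⟨inferInstanceAs (Finite (ULift.{w} (Fin n))), 𝒟'.isUStructure⟩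
  obtain ⟨-, ⟨k0⟩⟩ := this
  have hk0 : 𝒟'.IsEmb hU.str k0 := ⟨k0.injective, relE_embedding k0, relP_embedding k0⟩
  have hk1 : 𝒟.IsEmb hU.str (fun d => k0 ⟨e d⟩) := by
    refine hk0.comp (f := fun d => ⟨e d⟩) ((𝒟.isEmb_comap e' he').of_comp ?_)
    simpa [e'] using 𝒟.isEmb_id
  obtain ⟨h, hh⟩ := hU.exists_aut (hk1.comp hb) ha
  exact ⟨fun d => h (k0 ⟨e d⟩), (hU.isEmb_aut h).comp hk1, hh⟩

/-- A bijection preserving all relations is an automorphism. -/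
theorem exists_aut_of_equiv (hU : 𝔘.IsRandomisedUltrametricSpace U) (e : U ≃ U)
    (he : hU.str.IsEmb hU.str e) : ∃ g : AutGroup 𝔘.lang U, ∀ u, g u = e u :=
  ⟨show U ≃[𝔘.lang] U from
    { e with
      map_fun' := fun f => f.elim
      map_rel' := (embeddingOfRel e he.inj he.E he.P).map_rel' }, fun _ => rfl⟩

/-- A total and surjective relation all of whose finite parts extend to automorphisms is an
automorphism. -/
theorem exists_aut_of_finite (hU : 𝔘.IsRandomisedUltrametricSpace U) (r : U → U → Prop)
    (h1 : ∀ u, ∃ v, r u v) (h2 : ∀ v, ∃ u, r u v)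
    (h3 : ∀ p : Finset (U × U), (∀ x ∈ p, r x.1 x.2) →
      ∃ g : AutGroup 𝔘.lang U, ∀ x ∈ p, g x.1 = x.2) :
    ∃ g : AutGroup 𝔘.lang U, ∀ u v, r u v → g u = v := by
  classical
  choose f hf using h1
  have uniq : ∀ {u v v'}, r u v → r u v' → v = v' := fun {u v v'} h h' => by
    obtain ⟨g, hg⟩ := h3 {(u, v), (u, v')} (by simp [h, h'])
    exact (hg (u, v) (by simp)).symm.trans (hg (u, v') (by simp))
  have inj : ∀ {u u' v}, r u v → r u' v → u = u' := fun {u u' v} h h' => by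
    obtain ⟨g, hg⟩ := h3 {(u, v), (u', v)} (by simp [h, h'])
    exact EquivLike.injective g ((hg (u, v) (by simp)).trans (hg (u', v) (by simp)).symm)
  have hbij : Function.Bijective f := ⟨fun u u' h => inj (hf u) (h ▸ hf u'), fun v =>
    let ⟨u, hu⟩ := h2 v
    ⟨u, uniq (hf u) hu⟩⟩
  have fin : ∀ {ι : Type} [Finite ι] (x : ι → U),
      ∃ g : AutGroup 𝔘.lang U, ∀ j, g (x j) = f (x j) := fun {ι} _ x => by
    have := Fintype.ofFinite ι
    obtain ⟨g, hg⟩ := h3 (Finset.univ.image fun j => (x j, f (x j))) (by simp [hf])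
    exact ⟨g, fun j => hg (x j, f (x j)) (Finset.mem_image_of_mem _ (Finset.mem_univ _))⟩
  obtain ⟨g, hg⟩ := hU.exists_aut_of_equiv (Equiv.ofBijective f hbij) ⟨hbij.1, fun s x y => by
    obtain ⟨g, hg⟩ := fin ![x, y]
    have hx : g x = f x := hg 0
    have hy : g y = f y := hg 1
    simpa only [Equiv.ofBijective_apply, ← hx, ← hy] using (hU.isEmb_aut g).E s x y, fun i x => by
    obtain ⟨g, hg⟩ := fin x
    simpa only [Equiv.ofBijective_apply, ← hg] using (hU.isEmb_aut g).P i x⟩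
  exact ⟨g, fun u v h => (hg u).trans (uniq (hf u) h)⟩

end IsRandomisedUltrametricSpace

end UTuple

/-! ### Finite partial actions -/

namespace AutGroup

variable {L : FirstOrder.Language} {M : Type*} [L.Structure M]

@[simp]
theorem mul_apply (g h : AutGroup L M) (x : M) : (g * h) x = g (h x) := rfl

@[simp]
theorem one_apply (x : M) : (1 : AutGroup L M) x = x := rfl

@[simp]
theorem inv_apply_self (g : AutGroup L M) (x : M) : g⁻¹ (g x) = x := by
  rw [← mul_apply, inv_mul_cancel, one_apply]

@[simp]
theorem apply_inv_self (g : AutGroup L M) (x : M) : g (g⁻¹ x) = x := by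
  rw [← mul_apply, mul_inv_cancel, one_apply]

/-- An automorphism as a permutation. -/
def toPermHom (L : FirstOrder.Language) (M : Type*) [L.Structure M] :
    AutGroup L M →* Equiv.Perm M where
  toFun g := ⟨g, (g⁻¹ : AutGroup L M), inv_apply_self g, apply_inv_self g⟩
  map_one' := rfl
  map_mul' _ _ := rfl

end AutGroup

namespace RepSpace

variable {L : FirstOrder.Language} {M : Type*} [L.Structure M] {Γ : Type*}

/-- Finite sets are contained in finite invariant sets. -/
theorem exists_invariant [Group Γ] {ρ : RepSpace Γ (AutGroup L M)}
    (h : ∀ u, (Set.range fun γ => ρ γ u).Finite) (A : Finset M) : ∃ B : Finset M, A ⊆ B ∧ ∀ γ, ∀ b ∈ B, ρ γ b ∈ B := by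
  classical
  refine ⟨A.biUnion fun a => (h a).toFinset, fun a ha => ?_, fun γ b hb => ?_⟩
  · simp only [Finset.mem_biUnion, Set.Finite.mem_toFinset]
    exact ⟨a, ha, 1, by simp⟩
  · simp only [Finset.mem_biUnion, Set.Finite.mem_toFinset] at hb ⊢
    obtain ⟨a, ha, δ, rfl⟩ := hb
    exact ⟨a, ha, γ * δ, by simp⟩

/-- `g` conjugates the action `π` on the invariant set `C` to the action `ρ`. -/
structure Intertwines [Group Γ] (π ρ : RepSpace Γ (AutGroup L M)) (g : AutGroup L M)
    (C : Finset M) : Prop where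
  inv : ∀ γ, ∀ c ∈ C, π γ c ∈ C
  eq : ∀ γ, ∀ c ∈ C, ρ γ (g c) = g (π γ c)

theorem Intertwines.symm [Group Γ] [DecidableEq M] {π ρ : RepSpace Γ (AutGroup L M)}
    {g : AutGroup L M} {C : Finset M} (h : Intertwines π ρ g C) :
    Intertwines ρ π g⁻¹ (C.image g) := by
  constructor
  · intro γ d hd
    obtain ⟨c, hc, rfl⟩ := Finset.mem_image.1 hd
    rw [h.eq γ c hc]
    exact Finset.mem_image_of_mem _ (h.inv γ c hc)
  · intro γ d hd
    obtain ⟨c, hc, rfl⟩ := Finset.mem_image.1 hd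
    rw [h.eq γ c hc, AutGroup.inv_apply_self, AutGroup.inv_apply_self]

/-- Because `C` is invariant, generators suffice; for finitely generated `Γ`, intertwining on `C` is
then a finite condition on `ρ`, hence open. -/
theorem intertwines_of_closure [Group Γ] {π ρ : RepSpace Γ (AutGroup L M)} {g : AutGroup L M}
    {C : Finset M} {s : Set Γ} (hs : Subgroup.closure s = ⊤) (hC : ∀ γ, ∀ c ∈ C, π γ c ∈ C)
    (h : ∀ γ ∈ s, ∀ c ∈ C, ρ γ (g c) = g (π γ c)) : Intertwines π ρ g C := by
  refine ⟨hC, fun γ => ?_⟩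
  have hγ : γ ∈ Subgroup.closure s := hs ▸ Subgroup.mem_top γ
  induction hγ using Subgroup.closure_induction with
  | mem γ hγ => exact h γ hγ
  | one => simp
  | mul γ δ _ _ h1 h2 =>
    intro c hc
    rw [map_mul, map_mul, AutGroup.mul_apply, AutGroup.mul_apply, h2 c hc, h1 _ (hC δ c hc)]
  | inv γ _ h1 =>
    intro c hc
    have := h1 _ (hC γ⁻¹ c hc)
    rw [← AutGroup.mul_apply (π γ), ← map_mul, mul_inv_cancel, map_one, AutGroup.one_apply] at this
    rw [← this, map_inv, AutGroup.inv_apply_self]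

end RepSpace

theorem MonoidHom.finite_of_fg {G H : Type*} [Group G] [Group.FG G] [Group H] [Finite H] :
    Finite (G →* H) := by
  obtain ⟨s, hs⟩ := Group.fg_def.1 (inferInstance : Group.FG G)
  refine Finite.of_injective (fun (f : G →* H) (x : s) => f x) fun f g hfg => ?_
  exact MonoidHom.eq_of_eqOn_dense hs fun x hx => congrFun hfg ⟨x, hx⟩

namespace UTuple

variable {𝔘 : UTuple} {U : Type w} [𝔘.lang.Structure U] [Countable U]

/-- An action of `Γ` by automorphisms on a finite part of `U`. -/
structure FinAct (hU : 𝔘.IsRandomisedUltrametricSpace U) (Γ : Type u) [Group Γ] where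
  carrier : Finset U
  act : Γ →* Equiv.Perm carrier
  isAct : (hU.str.comap (Subtype.val : carrier → U) Subtype.val_injective).IsAct act

namespace FinAct

variable {hU : 𝔘.IsRandomisedUltrametricSpace U} {Γ : Type u} [Group Γ]

/-- The graph of the action. -/
def Rel (p : FinAct hU Γ) (γ : Γ) (u v : U) : Prop :=
  ∃ h : u ∈ p.carrier, (p.act γ ⟨u, h⟩ : U) = v

theorem Rel.left_mem {p : FinAct hU Γ} {γ : Γ} {u v : U} (h : p.Rel γ u v) : u ∈ p.carrier := h.1

theorem Rel.right_mem {p : FinAct hU Γ} {γ : Γ} {u v : U} (h : p.Rel γ u v) : v ∈ p.carrier := by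
  obtain ⟨_, rfl⟩ := h
  exact Subtype.prop _

theorem exists_rel (p : FinAct hU Γ) (γ : Γ) {u : U} (h : u ∈ p.carrier) : ∃ v, p.Rel γ u v :=
  ⟨_, h, rfl⟩

theorem rel_one {p : FinAct hU Γ} {u : U} (h : u ∈ p.carrier) : p.Rel 1 u u := ⟨h, by simp⟩

theorem Rel.mul {p : FinAct hU Γ} {γ δ : Γ} {u v x : U} (h : p.Rel γ v x) (h' : p.Rel δ u v) :
    p.Rel (γ * δ) u x := by
  obtain ⟨h', rfl⟩ := h'
  obtain ⟨h, rfl⟩ := h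
  exact ⟨h', by simp⟩

theorem Rel.inv {p : FinAct hU Γ} {γ : Γ} {u v : U} (h : p.Rel γ u v) : p.Rel γ⁻¹ v u := by
  obtain ⟨h, rfl⟩ := h
  exact ⟨Subtype.prop _, by simp⟩

instance : Preorder (FinAct hU Γ) where
  le p q := ∀ γ u v, p.Rel γ u v → q.Rel γ u v
  le_refl _ _ _ _ h := h
  le_trans _ _ _ h h' _ _ _ hp := h' _ _ _ (h _ _ _ hp)

theorem carrier_mono {p q : FinAct hU Γ} (h : p ≤ q) {u : U} (hu : u ∈ p.carrier) :
    u ∈ q.carrier := (h _ _ _ (rel_one hu)).left_mem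

/-- A finitely generated group has only finitely many actions on a given finite set. Countability is
what lets a chain of finite actions meet all extension requirements. -/
instance [Group.FG Γ] : Countable (FinAct hU Γ) := by
  have : ∀ B : Finset U, Finite (Γ →* Equiv.Perm B) := fun B => MonoidHom.finite_of_fg
  refine Function.Injective.countable
    (f := fun p : FinAct hU Γ => (⟨p.carrier, p.act⟩ : Σ B : Finset U, Γ →* Equiv.Perm B)) ?_
  rintro ⟨B, α, h⟩ ⟨B', α', h'⟩ he
  cases he
  rfl

/-- The finite action transported along an embedding in `U`. -/
theorem exists_ofEmb {D : Type*} [Finite D] {𝒟 : 𝔘.Str D} {σ : Γ →* Equiv.Perm D}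
    (hσ : 𝒟.IsAct σ) {k : D → U} (hk : 𝒟.IsEmb hU.str k) :
    ∃ p : FinAct hU Γ, ∀ γ u v, p.Rel γ u v ↔ ∃ d, k d = u ∧ k (σ γ d) = v := by
  let e0 : D ≃ Set.range k := Equiv.ofInjective k hk.inj
  let e : D ≃ (Set.finite_range k).toFinset :=
    e0.trans (Equiv.subtypeEquivRight fun x => by simp)
  have he : ∀ d, (e d : U) = k d := fun d => rfl
  have hE : (hU.str.comap (Subtype.val : (Set.finite_range k).toFinset → U)
      Subtype.val_injective).IsEmb 𝒟 e.symm := by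
    refine hk.of_comp ?_
    have : ∀ x, k (e.symm x) = x := fun x => by rw [← he, e.apply_symm_apply]
    simp only [this]
    exact hU.str.isEmb_comap _ _
  refine ⟨⟨(Set.finite_range k).toFinset, e.permCongrHom.toMonoidHom.comp σ, fun γ =>
    Str.IsEmb.of_comp (hU.str.isEmb_comap _ _) (hk.comp ((hσ γ).comp hE))⟩, fun γ u v => ?_⟩
  constructor
  · rintro ⟨h, hv⟩
    refine ⟨e.symm ⟨u, h⟩, ?_, hv⟩
    rw [← he, e.apply_symm_apply]
  · rintro ⟨d, rfl, rfl⟩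
    refine ⟨(e d).2, ?_⟩
    change k (σ γ (e.symm (e d))) = _
    rw [e.symm_apply_apply]

theorem exists_map (p : FinAct hU Γ) (g : AutGroup 𝔘.lang U) :
    ∃ q : FinAct hU Γ, ∀ γ u v, q.Rel γ (g u) (g v) ↔ p.Rel γ u v := by
  obtain ⟨q, hq⟩ := exists_ofEmb (hU := hU) p.isAct ((hU.isEmb_aut g).comp (hU.str.isEmb_comap _ _))
  refine ⟨q, fun γ u v => (hq γ _ _).trans ⟨?_, ?_⟩⟩
  · rintro ⟨d, h1, h2⟩
    obtain rfl := EquivLike.injective g h1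
    obtain rfl := EquivLike.injective g h2
    exact ⟨d.2, rfl⟩
  · rintro ⟨h, rfl⟩
    exact ⟨⟨u, h⟩, rfl, rfl⟩

/-- The restriction of a representation to a finite invariant set. -/
theorem exists_ofRep (hU : 𝔘.IsRandomisedUltrametricSpace U) (π : RepSpace Γ (AutGroup 𝔘.lang U))
    (B : Finset U) (hB : ∀ γ, ∀ b ∈ B, π γ b ∈ B) :
    ∃ p : FinAct hU Γ, ∀ γ u v, p.Rel γ u v ↔ u ∈ B ∧ π γ u = v := by
  let α : Γ →* Equiv.Perm B := MonoidHom.toHomPerm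
    { toFun := fun γ b => ⟨π γ b, hB γ b b.2⟩
      map_one' := funext fun b => Subtype.ext (by simp; rfl)
      map_mul' := fun γ δ => funext fun b => Subtype.ext (by simp; rfl) }
  refine ⟨⟨B, α, fun γ => Str.IsEmb.of_comp (hU.str.isEmb_comap _ _)
    ((hU.isEmb_aut (π γ)).comp (hU.str.isEmb_comap _ _))⟩, fun γ u v => ?_⟩
  exact ⟨fun ⟨h, h'⟩ => ⟨h, h'⟩, fun ⟨h, h'⟩ => ⟨h, h'⟩⟩

end FinAct

end UTuple

/-! ### Extending and amalgamating finite actions inside `U` -/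

namespace UTuple

variable {𝔘 : UTuple} {U : Type w} [𝔘.lang.Structure U] [Countable U]

namespace FinAct

variable {hU : 𝔘.IsRandomisedUltrametricSpace U} {Γ : Type u}

section

variable [CommGroup Γ] [Group.FG Γ]

/-- The abstract equivariant amalgam is embedded in `U` with `p` kept in place; homogeneity then
supplies `g`, which moves `q` to its copy while fixing `A`. -/
theorem exists_amalgam {Δ : Type*} [Group Δ] {φ : Δ →* Γ} (hφ : Function.Injective φ)
    (p : FinAct hU Γ) (q : FinAct hU Δ) (A : Finset U)
    (h : ∀ δ, ∀ a ∈ A, ∃ v ∈ A, p.Rel (φ δ) a v ∧ q.Rel δ a v) :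
    ∃ p' ≥ p, ∃ g : AutGroup 𝔘.lang U, (∀ a ∈ A, g a = a) ∧
      ∀ δ u v, q.Rel δ u v → p'.Rel (φ δ) (g u) (g v) := by
  choose! α hαA hαp hαq using h
  let emb := fun B : Finset U => hU.str.isEmb_comap (Subtype.val : B → U) Subtype.val_injective
  obtain ⟨D, hD, 𝒟, σ, fB, fC, h1, h2, h3, h4, h5, h6⟩ := exists_equivariant_amalgam φ hφ p.isAct
    q.isAct (α := fun δ (a : A) => (⟨α δ a, hαA δ a a.2⟩ : A))
    (iB := fun a : A => ⟨a, by simpa using (hαp 1 a a.2).left_mem⟩)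
    (iC := fun a : A => ⟨a, (hαq 1 a a.2).left_mem⟩)
    ((emb p.carrier).of_comp (emb A)) ((emb q.carrier).of_comp (emb A))
    (fun δ a => Subtype.ext (hαp δ a a.2).2.symm) (fun δ a => Subtype.ext (hαq δ a a.2).2.symm)
  obtain ⟨k, hk, hk'⟩ := hU.exists_emb h2 (emb p.carrier)
  obtain ⟨p', hp'⟩ := exists_ofEmb h1 hk
  obtain ⟨g, hg⟩ := hU.exists_aut (emb q.carrier) (hk.comp h3)
  refine ⟨p', ?_, g, fun a ha => ?_, ?_⟩
  · rintro γ u v ⟨hu, rfl⟩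
    exact (hp' _ _ _).2 ⟨fB ⟨u, hu⟩, hk' _, by rw [← h5, hk']⟩
  · have := hg ⟨a, (hαq 1 a ha).left_mem⟩
    rwa [← h4 ⟨a, ha⟩, hk'] at this
  · rintro δ u v ⟨hu, rfl⟩
    exact (hp' _ _ _).2 ⟨fC ⟨u, hu⟩, (hg ⟨u, hu⟩).symm, by rw [← h6, ← hg]⟩

/-- The point is added by amalgamating with the trivial subgroup acting on `p.carrier ∪ {u}`. The
amalgam contains `g u`, and `g⁻¹` brings it back without moving `p`. -/
theorem exists_ge_mem (p : FinAct hU Γ) (u : U) : ∃ p' ≥ p, u ∈ p'.carrier := by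
  classical
  let q : FinAct hU (⊥ : Subgroup Γ) := ⟨insert u p.carrier, 1, fun _ => Str.isEmb_id _⟩
  have hq : ∀ v ∈ insert u p.carrier, ∀ δ, q.Rel δ v v := fun v hv δ => ⟨hv, rfl⟩
  obtain ⟨p', hp', g, hg, hg'⟩ := exists_amalgam (φ := (⊥ : Subgroup Γ).subtype)
    Subtype.val_injective p q p.carrier fun δ a ha => by
      obtain rfl : δ = 1 := Subsingleton.elim _ _
      exact ⟨a, ha, rel_one ha, hq a (Finset.mem_insert_of_mem ha) _⟩
  obtain ⟨r, hr⟩ := p'.exists_map g⁻¹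
  refine ⟨r, fun γ x y hxy => ?_, ?_⟩
  · have := (hr γ x y).2 (hp' _ _ _ hxy)
    have ex := congrArg (g⁻¹ : AutGroup 𝔘.lang U) (hg x hxy.left_mem)
    have ey := congrArg (g⁻¹ : AutGroup 𝔘.lang U) (hg y hxy.right_mem)
    rw [AutGroup.inv_apply_self] at ex ey
    rwa [← ex, ← ey] at this
  · have := (hr 1 (g u) (g u)).2 (hg' 1 u u (hq u (Finset.mem_insert_self _ _) 1))
    rw [AutGroup.inv_apply_self] at this
    exact this.left_mem

theorem exists_ge_subset (p : FinAct hU Γ) (A : Finset U) : ∃ p' ≥ p, A ⊆ p'.carrier := by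
  classical
  induction A using Finset.induction_on with
  | empty => exact ⟨p, le_rfl, Finset.empty_subset _⟩
  | insert a A _ ih =>
    obtain ⟨p1, h1, hA⟩ := ih
    obtain ⟨p2, h2, ha⟩ := p1.exists_ge_mem a
    exact ⟨p2, h1.trans h2, Finset.insert_subset ha fun x hx => carrier_mono h2 (hA hx)⟩

/-- A finite part of a representation extends to a finite action. -/
theorem exists_approx (hU : 𝔘.IsRandomisedUltrametricSpace U) (π : RepSpace Γ (AutGroup 𝔘.lang U))
    (F : Finset U) :
    ∃ p : FinAct hU Γ, ∀ γ, ∀ x ∈ F, π γ x ∈ F → p.Rel γ x (π γ x) := by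
  let emb := hU.str.isEmb_comap (Subtype.val : F → U) Subtype.val_injective
  obtain ⟨D, hD, 𝒟, σ, f, h1, h2, h3⟩ := hU.str.exists_finite_approx
    ((AutGroup.toPermHom 𝔘.lang U).comp (show Γ →* AutGroup 𝔘.lang U from π))
    (fun γ => hU.isEmb_aut (π γ)) (Subtype.val : F → U) Subtype.val_injective
  obtain ⟨k, hk, hk'⟩ := hU.exists_emb h2 emb
  obtain ⟨p, hp⟩ := exists_ofEmb h1 hk
  refine ⟨p, fun γ x hx hy => (hp _ _ _).2 ⟨f ⟨x, hx⟩, hk' _, ?_⟩⟩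
  rw [h3 ⟨π γ x, hy⟩ γ ⟨x, hx⟩ rfl, hk']

end

end FinAct

/-! ### Existence of representations with the extension property -/

/-- All orbits are finite, and every extension of a finite invariant part to a finite action is
realised. -/
structure IsExtensive [Group Γ] (hU : 𝔘.IsRandomisedUltrametricSpace U)
    (ρ : RepSpace Γ (AutGroup 𝔘.lang U)) : Prop where
  finite_orbit : ∀ u, (Set.range fun γ => ρ γ u).Finite
  extend : ∀ (q : FinAct hU Γ) (A : Finset U),
    (∀ γ, ∀ a ∈ A, ρ γ a ∈ A ∧ q.Rel γ a (ρ γ a)) →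
    ∃ g : AutGroup 𝔘.lang U, (∀ a ∈ A, g a = a) ∧ ∀ γ u v, q.Rel γ u v → ρ γ (g u) = g v

variable {hU : 𝔘.IsRandomisedUltrametricSpace U} {Γ : Type u}

theorem FinAct.exists_isExtensive [CommGroup Γ] [Group.FG Γ] (p : FinAct hU Γ) :
    ∃ ρ : RepSpace Γ (AutGroup 𝔘.lang U), IsExtensive hU ρ ∧ ∀ γ u v, p.Rel γ u v → ρ γ u = v := by
  classical
  let ι := U ⊕ (FinAct hU Γ × Finset U)
  have : Encodable ι := Encodable.ofCountable ι
  let 𝒟 : ι → Order.Cofinal (FinAct hU Γ) := Sum.elim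
    (fun u => ⟨{p | u ∈ p.carrier}, fun p =>
      let ⟨p', h, h'⟩ := p.exists_ge_mem u
      ⟨p', h', h⟩⟩)
    -- Requiring `x.2 ⊆ p.carrier` settles the action on `x.2`, so compatibility with `x.1` is
    -- already decided by `p`.
    (fun x => ⟨{p | x.2 ⊆ p.carrier ∧ ((∀ γ, ∀ a ∈ x.2, ∃ v ∈ x.2, p.Rel γ a v ∧ x.1.Rel γ a v) →
        ∃ g : AutGroup 𝔘.lang U, (∀ a ∈ x.2, g a = a) ∧
          ∀ γ u v, x.1.Rel γ u v → p.Rel γ (g u) (g v))}, fun p => by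
      obtain ⟨p1, h1, hA⟩ := p.exists_ge_subset x.2
      by_cases h : ∀ γ, ∀ a ∈ x.2, ∃ v ∈ x.2, p1.Rel γ a v ∧ x.1.Rel γ a v
      · obtain ⟨p2, h2, hg⟩ := FinAct.exists_amalgam (φ := MonoidHom.id Γ) (fun _ _ h => h) p1 x.1
          x.2 h
        exact ⟨p2, ⟨fun a ha => FinAct.carrier_mono h2 (hA ha), fun _ => hg⟩, h1.trans h2⟩
      · exact ⟨p1, ⟨hA, fun h' => (h h').elim⟩, h1⟩⟩)
  -- A directed family meeting all the countably many requirements; the union of its actions is `ρ`.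
  let I := Order.idealOfCofinals p 𝒟
  have hp : p ∈ I := Order.mem_idealOfCofinals p 𝒟
  have hmem : ∀ u, ∃ q ∈ I, u ∈ q.carrier := fun u =>
    let ⟨q, h1, h2⟩ := Order.cofinal_meets_idealOfCofinals p 𝒟 (.inl u)
    ⟨q, h2, h1⟩
  have hdir : ∀ (γ : Γ) (P : Finset (U × U)), (∀ x ∈ P, ∃ q ∈ I, q.Rel γ x.1 x.2) →
      ∃ q ∈ I, ∀ x ∈ P, q.Rel γ x.1 x.2 := by
    intro γ P
    induction P using Finset.induction_on with
    | empty => exact fun _ => ⟨p, hp, by simp⟩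
    | insert x P _ ih =>
      intro h
      obtain ⟨q, hq, hqx⟩ := h x (Finset.mem_insert_self _ _)
      obtain ⟨q', hq', hqP⟩ := ih fun y hy => h y (Finset.mem_insert_of_mem hy)
      obtain ⟨q'', hq'', h1, h2⟩ := I.directed q hq q' hq'
      refine ⟨q'', hq'', fun y hy => ?_⟩
      rcases Finset.mem_insert.1 hy with rfl | hy
      · exact h1 _ _ _ hqx
      · exact h2 _ _ _ (hqP y hy)
  have key : ∀ γ : Γ, ∃ g : AutGroup 𝔘.lang U, ∀ u v, (∃ q ∈ I, q.Rel γ u v) → g u = v := by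
    refine fun γ => hU.exists_aut_of_finite _ (fun u => ?_) (fun v => ?_) (fun P hP => ?_)
    · obtain ⟨q, hq, hu⟩ := hmem u
      obtain ⟨v, hv⟩ := q.exists_rel γ hu
      exact ⟨v, q, hq, hv⟩
    · obtain ⟨q, hq, hv⟩ := hmem v
      obtain ⟨u, hu⟩ := q.exists_rel γ⁻¹ hv
      exact ⟨u, q, hq, by simpa using hu.inv⟩
    · obtain ⟨q, hq, hqP⟩ := hdir γ P hP
      have emb := hU.str.isEmb_comap (Subtype.val : q.carrier → U) Subtype.val_injective
      obtain ⟨g, hg⟩ := hU.exists_aut emb (emb.comp (q.isAct γ))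
      exact ⟨g, fun x hx => (hg ⟨x.1, (hqP x hx).1⟩).trans (hqP x hx).2⟩
  choose f hf using key
  let ρ : RepSpace Γ (AutGroup 𝔘.lang U) := MonoidHom.mk' f fun γ δ => by
    refine DFunLike.ext _ _ fun u => ?_
    obtain ⟨q, hq, hu⟩ := hmem u
    obtain ⟨v, hv⟩ := q.exists_rel δ hu
    obtain ⟨x, hx⟩ := q.exists_rel γ hv.right_mem
    rw [AutGroup.mul_apply, hf δ u v ⟨q, hq, hv⟩, hf γ v x ⟨q, hq, hx⟩]
    exact hf _ _ _ ⟨q, hq, hx.mul hv⟩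
  have hρ : ∀ q ∈ I, ∀ γ u v, q.Rel γ u v → ρ γ u = v := fun q hq γ u v h => hf γ u v ⟨q, hq, h⟩
  have hρ' : ∀ q ∈ I, ∀ γ, ∀ u ∈ q.carrier, q.Rel γ u (ρ γ u) := fun q hq γ u hu => by
    obtain ⟨v, hv⟩ := q.exists_rel γ hu
    rwa [hρ q hq γ u v hv]
  refine ⟨ρ, ⟨fun u => ?_, fun q A hA => ?_⟩, hρ p hp⟩
  · obtain ⟨q, hq, hu⟩ := hmem u
    refine q.carrier.finite_toSet.subset ?_
    rintro _ ⟨γ, rfl⟩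
    exact (hρ' q hq γ u hu).right_mem
  · obtain ⟨r, ⟨h1, h2⟩, hr⟩ := Order.cofinal_meets_idealOfCofinals p 𝒟 (.inr (q, A))
    obtain ⟨g, hg, hg'⟩ := h2 fun γ a ha =>
      ⟨ρ γ a, (hA γ a ha).1, hρ' r hr γ a (h1 ha), (hA γ a ha).2⟩
    exact ⟨g, hg, fun γ u v h => hρ r hr _ _ _ (hg' γ u v h)⟩

/-! ### Uniqueness -/

/-- The single step of the back-and-forth: `g` carries the action of `π` on `C'` to a finite action
extending `ρ` on the image of `C`, and `ρ` realises it. -/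
theorem IsExtensive.extend_intertwines [Group Γ] {π ρ : RepSpace Γ (AutGroup 𝔘.lang U)}
    (hρ : IsExtensive hU ρ) {g : AutGroup 𝔘.lang U} {C C' : Finset U}
    (h : RepSpace.Intertwines π ρ g C) (hC : C ⊆ C') (hC' : ∀ γ, ∀ c ∈ C', π γ c ∈ C') :
    ∃ g', (∀ c ∈ C, g' c = g c) ∧ RepSpace.Intertwines π ρ g' C' := by
  classical
  obtain ⟨p, hp⟩ := FinAct.exists_ofRep hU π C' hC'
  obtain ⟨q, hq⟩ := p.exists_map g
  obtain ⟨k, hk, hk'⟩ := hρ.extend q (C.image g) fun γ a ha => by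
    obtain ⟨c, hc, rfl⟩ := Finset.mem_image.1 ha
    rw [h.eq γ c hc, hq, hp]
    exact ⟨Finset.mem_image_of_mem _ (h.inv γ c hc), hC hc, rfl⟩
  exact ⟨k * g, fun c hc => hk _ (Finset.mem_image_of_mem _ hc), hC',
    fun γ c hc => hk' γ _ _ ((hq _ _ _).2 ((hp _ _ _).2 ⟨hc, rfl⟩))⟩

/-- Domains grow by the hypothesis `hρ`, ranges by the extension property of `π` applied to the
inverse. Only the forth step relative to `π` is asked of `ρ`, since this is what the category
argument supplies. -/
theorem IsExtensive.exists_conj_of_extend [Group Γ] {π ρ : RepSpace Γ (AutGroup 𝔘.lang U)}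
    (hπ : IsExtensive hU π) (hfin : ∀ u, (Set.range fun γ => ρ γ u).Finite)
    (hρ : ∀ (g : AutGroup 𝔘.lang U) (C C' : Finset U), RepSpace.Intertwines π ρ g C → C ⊆ C' →
      (∀ γ, ∀ c ∈ C', π γ c ∈ C') →
      ∃ g' : AutGroup 𝔘.lang U, (∀ c ∈ C, g' c = g c) ∧ RepSpace.Intertwines π ρ g' C')
    {g0 : AutGroup 𝔘.lang U} {B : Finset U} (hB : RepSpace.Intertwines π ρ g0 B) :
    ∃ g : AutGroup 𝔘.lang U, (∀ b ∈ B, g b = g0 b) ∧ ∀ γ, ρ γ = g * π γ * g⁻¹ := by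
  classical
  let Q := {x : Finset U × AutGroup 𝔘.lang U // RepSpace.Intertwines π ρ x.2 x.1}
  let _ : Preorder Q :=
    { le := fun x y => x.1.1 ⊆ y.1.1 ∧ ∀ c ∈ x.1.1, y.1.2 c = x.1.2 c
      le_refl := fun x => ⟨subset_rfl, fun _ _ => rfl⟩
      le_trans := fun x y z h h' => ⟨h.1.trans h'.1, fun c hc =>
        (h'.2 c (h.1 hc)).trans (h.2 c hc)⟩ }
  have : Encodable (U ⊕ U) := Encodable.ofCountable _
  let 𝒟 : U ⊕ U → Order.Cofinal Q := Sum.elim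
    (fun u => ⟨{x | u ∈ x.1.1}, fun x => by
      obtain ⟨C', hC, hC'⟩ := RepSpace.exists_invariant hπ.finite_orbit (insert u x.1.1)
      obtain ⟨g', hg, hg'⟩ := hρ _ _ _ x.2
        ((Finset.subset_insert _ _).trans hC) hC'
      exact ⟨⟨(C', g'), hg'⟩, hC (Finset.mem_insert_self _ _),
        (Finset.subset_insert _ _).trans hC, hg⟩⟩)
    (fun v => ⟨{x | v ∈ x.1.1.image x.1.2}, fun x => by
      obtain ⟨C', hC, hC'⟩ := RepSpace.exists_invariant hfin (insert v (x.1.1.image x.1.2))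
      obtain ⟨g', hg, hg'⟩ := hπ.extend_intertwines x.2.symm
        ((Finset.subset_insert _ _).trans hC) hC'
      have hx : ∀ c ∈ x.1.1, g' (x.1.2 c) = c := fun c hc => by
        rw [hg _ (Finset.mem_image_of_mem _ hc), AutGroup.inv_apply_self]
      refine ⟨⟨(C'.image g', g'⁻¹), hg'.symm⟩, ?_, fun c hc => ?_, fun c hc => ?_⟩
      · refine Finset.mem_image.2 ⟨g' v, Finset.mem_image_of_mem _
          (hC (Finset.mem_insert_self _ _)), AutGroup.inv_apply_self _ _⟩
      · refine Finset.mem_image.2 ⟨x.1.2 c, ?_, hx c hc⟩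
        exact hC (Finset.mem_insert_of_mem (Finset.mem_image_of_mem _ hc))
      · conv_lhs => rw [← hx c hc]
        exact AutGroup.inv_apply_self _ _⟩)
  let x0 : Q := ⟨(B, g0), hB⟩
  let I := Order.idealOfCofinals x0 𝒟
  have hx0 : x0 ∈ I := Order.mem_idealOfCofinals x0 𝒟
  have hmem : ∀ u, ∃ x ∈ I, u ∈ x.1.1 := fun u =>
    let ⟨x, h1, h2⟩ := Order.cofinal_meets_idealOfCofinals x0 𝒟 (.inl u)
    ⟨x, h2, h1⟩
  obtain ⟨g, hg⟩ := hU.exists_aut_of_finite (fun u v => ∃ x ∈ I, u ∈ x.1.1 ∧ x.1.2 u = v)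
    (fun u => let ⟨x, hx, hu⟩ := hmem u; ⟨_, x, hx, hu, rfl⟩)
    (fun v => by
      obtain ⟨x, h1, h2⟩ := Order.cofinal_meets_idealOfCofinals x0 𝒟 (.inr v)
      obtain ⟨u, hu, rfl⟩ := Finset.mem_image.1 h1
      exact ⟨u, x, h2, hu, rfl⟩)
    (fun P hP => by
      have : ∃ x ∈ I, ∀ y ∈ P, y.1 ∈ x.1.1 ∧ x.1.2 y.1 = y.2 := by
        induction P using Finset.induction_on with
        | empty => exact ⟨x0, hx0, by simp⟩
        | insert z P _ ih =>
          obtain ⟨x, hx, hxz⟩ := hP z (Finset.mem_insert_self _ _)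
          obtain ⟨x', hx', hxP⟩ := ih fun y hy => hP y (Finset.mem_insert_of_mem hy)
          obtain ⟨x'', hx'', h1, h2⟩ := I.directed x hx x' hx'
          refine ⟨x'', hx'', fun y hy => ?_⟩
          rcases Finset.mem_insert.1 hy with rfl | hy
          · exact ⟨h1.1 hxz.1, (h1.2 _ hxz.1).trans hxz.2⟩
          · exact ⟨h2.1 (hxP y hy).1, (h2.2 _ (hxP y hy).1).trans (hxP y hy).2⟩
      obtain ⟨x, _, hx⟩ := this
      exact ⟨x.1.2, fun y hy => (hx y hy).2⟩)
  refine ⟨g, fun b hb => hg b _ ⟨x0, hx0, hb, rfl⟩, fun γ => ?_⟩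
  rw [eq_mul_inv_iff_mul_eq]
  refine DFunLike.ext _ _ fun u => ?_
  obtain ⟨x, hx, hu⟩ := hmem u
  rw [AutGroup.mul_apply, AutGroup.mul_apply, hg u _ ⟨x, hx, hu, rfl⟩,
    hg _ _ ⟨x, hx, x.2.inv γ u hu, rfl⟩]
  exact x.2.eq γ u hu

/-- Representations with the extension property are conjugate over any finite invariant set on
which they agree. -/
theorem IsExtensive.exists_conj [Group Γ] {π ρ : RepSpace Γ (AutGroup 𝔘.lang U)}
    (hπ : IsExtensive hU π) (hρ : IsExtensive hU ρ) {g0 : AutGroup 𝔘.lang U} {B : Finset U}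
    (hB : RepSpace.Intertwines π ρ g0 B) :
    ∃ g : AutGroup 𝔘.lang U, (∀ b ∈ B, g b = g0 b) ∧ ∀ γ, ρ γ = g * π γ * g⁻¹ :=
  hπ.exists_conj_of_extend hρ.finite_orbit (fun _ _ _ h => hρ.extend_intertwines h) hB

/-- The extension property is invariant under conjugation. -/
theorem IsExtensive.conj [Group Γ] {π ρ : RepSpace Γ (AutGroup 𝔘.lang U)}
    (hπ : IsExtensive hU π) {g : AutGroup 𝔘.lang U} (hg : ∀ γ, ρ γ = g * π γ * g⁻¹) :
    IsExtensive hU ρ := by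
  classical
  refine ⟨fun u => ?_, fun q A hA => ?_⟩
  · refine ((hπ.finite_orbit (g⁻¹ u)).image g).subset ?_
    rintro _ ⟨γ, rfl⟩
    exact ⟨_, ⟨γ, rfl⟩, by simp [hg]⟩
  · obtain ⟨r, hr⟩ := q.exists_map g⁻¹
    obtain ⟨k, hk, hk'⟩ := hπ.extend r (A.image (g⁻¹ : AutGroup 𝔘.lang U)) fun γ a ha => by
      obtain ⟨b, hb, rfl⟩ := Finset.mem_image.1 ha
      have e : π γ (g⁻¹ b) = g⁻¹ (ρ γ b) := by simp [hg]
      rw [e, hr]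
      exact ⟨Finset.mem_image_of_mem _ (hA γ b hb).1, (hA γ b hb).2⟩
    refine ⟨g * k * g⁻¹, fun a ha => ?_, fun γ u v huv => ?_⟩
    · simp [hk _ (Finset.mem_image_of_mem _ ha)]
    · simp [hg, hk' _ _ _ ((hr _ _ _).2 huv)]

/-- The extension property passes to subgroups. -/
theorem IsExtensive.comp [CommGroup Γ] [Group.FG Γ] {ρ : RepSpace Γ (AutGroup 𝔘.lang U)}
    (hρ : IsExtensive hU ρ) {Δ : Type*} [Group Δ] {φ : Δ →* Γ} (hφ : Function.Injective φ)
    {π : RepSpace Δ (AutGroup 𝔘.lang U)} (hπ : ∀ δ, π δ = ρ (φ δ)) : IsExtensive hU π := by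
  refine ⟨fun u => (hρ.finite_orbit u).subset ?_, fun q A hA => ?_⟩
  · rintro _ ⟨δ, rfl⟩
    exact ⟨φ δ, by simp [hπ]⟩
  -- The extension property of `ρ` needs a `Γ`-invariant base, so `A` is enlarged to `B`;
  -- amalgamation over `A` turns `q` into part of a `Γ`-action extending `ρ` on `B`.
  · obtain ⟨B, hAB, hB⟩ := RepSpace.exists_invariant hρ.finite_orbit A
    obtain ⟨p, hp⟩ := FinAct.exists_ofRep hU ρ B hB
    obtain ⟨p', hpp', g, hg, hg'⟩ := FinAct.exists_amalgam hφ p q A fun δ a ha =>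
      ⟨π δ a, (hA δ a ha).1, (hp _ _ _).2 ⟨hAB ha, by rw [hπ]⟩, (hA δ a ha).2⟩
    obtain ⟨k, hk, hk'⟩ := hρ.extend p' B fun γ b hb =>
      ⟨hB γ b hb, hpp' _ _ _ ((hp _ _ _).2 ⟨hb, rfl⟩)⟩
    refine ⟨k * g, fun a ha => ?_, fun δ u v huv => ?_⟩
    · rw [AutGroup.mul_apply, hg a ha, hk a (hAB ha)]
    · rw [hπ]
      exact hk' _ _ _ (hg' _ _ _ huv)

end UTuple

/-! ### The topology of the space of representations -/

namespace RepSpace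

variable {L : FirstOrder.Language} {M : Type*} [L.Structure M] {Γ : Type*} [Group Γ]

theorem isInducing_apply : letI : TopologicalSpace M := ⊥
    Topology.IsInducing (fun (ρ : RepSpace Γ (AutGroup L M)) (γ : Γ) (x : M) => ρ γ x) :=
  letI : TopologicalSpace M := ⊥
  have h1 : Topology.IsInducing (fun (ρ : RepSpace Γ (AutGroup L M)) (γ : Γ) => ρ γ) := ⟨rfl⟩
  have h2 : Topology.IsInducing (fun (g : AutGroup L M) (x : M) => g x) := ⟨rfl⟩
  (Topology.IsInducing.piMap fun _ : Γ => h2).comp h1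

theorem isOpen_apply_eq (γ : Γ) (x y : M) :
    IsOpen {ρ : RepSpace Γ (AutGroup L M) | ρ γ x = y} := by
  let _ : TopologicalSpace M := ⊥
  have : DiscreteTopology M := ⟨rfl⟩
  have hc : Continuous (fun ρ : RepSpace Γ (AutGroup L M) => ρ γ x) :=
    (continuous_apply x).comp ((continuous_apply γ).comp isInducing_apply.continuous)
  exact (isOpen_discrete {y}).preimage hc

theorem exists_finset_of_isOpen {W : Set (RepSpace Γ (AutGroup L M))} (hW : IsOpen W)
    {σ : RepSpace Γ (AutGroup L M)} (hσ : σ ∈ W) : ∃ (K : Finset Γ) (F : Finset M),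
      ∀ ρ : RepSpace Γ (AutGroup L M), (∀ γ ∈ K, ∀ x ∈ F, ρ γ x = σ γ x) → ρ ∈ W := by
  classical
  let _ : TopologicalSpace M := ⊥
  obtain ⟨W', hW', rfl⟩ := isInducing_apply.isOpen_iff.1 hW
  obtain ⟨K, u, hu, hK⟩ := isOpen_pi_iff.1 hW' _ hσ
  have : ∀ γ : Γ, ∃ F : Finset M, γ ∈ K → ∀ f : M → M, (∀ x ∈ F, f x = σ γ x) → f ∈ u γ := by
    intro γ
    by_cases hγ : γ ∈ K
    · obtain ⟨F, v, hv, hF⟩ := isOpen_pi_iff.1 (hu γ hγ).1 _ (hu γ hγ).2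
      refine ⟨F, fun _ f hf => hF fun x hx => ?_⟩
      rw [hf x hx]
      exact (hv x hx).2
    · exact ⟨∅, fun h => (hγ h).elim⟩
  choose F hF using this
  refine ⟨K, K.biUnion F, fun ρ hρ => hK fun γ hγ => hF γ hγ _ fun x hx => ?_⟩
  exact hρ γ hγ x (Finset.mem_biUnion.2 ⟨γ, hγ, hx⟩)

end RepSpace

namespace UTuple

variable {𝔘 : UTuple} {U : Type w} [𝔘.lang.Structure U] [Countable U]
  {hU : 𝔘.IsRandomisedUltrametricSpace U} {Γ : Type u} [CommGroup Γ] [Group.FG Γ]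

section

variable {X : Type*} [TopologicalSpace X] {r : X → RepSpace Γ (AutGroup 𝔘.lang U)}

omit [Countable U] in
theorem isOpen_intertwines (hr : ∀ γ u v, IsOpen {x | r x γ u = v})
    (π : RepSpace Γ (AutGroup 𝔘.lang U)) (g : AutGroup 𝔘.lang U) (C : Finset U) :
    IsOpen {x | RepSpace.Intertwines π (r x) g C} := by
  obtain ⟨s, hs⟩ := Group.fg_def.1 (inferInstance : Group.FG Γ)
  by_cases hC : ∀ γ, ∀ c ∈ C, π γ c ∈ C
  · have : {x | RepSpace.Intertwines π (r x) g C} =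
        ⋂ γ ∈ s, ⋂ c ∈ C, {x | r x γ (g c) = g (π γ c)} := by
      ext x
      simp only [Set.mem_iInter]
      exact ⟨fun h γ _ c hc => h.eq γ c hc, fun h => RepSpace.intertwines_of_closure hs hC h⟩
    rw [this]
    exact isOpen_biInter_finset fun γ _ => isOpen_biInter_finset fun c _ => hr _ _ _
  · convert isOpen_empty
    exact Set.eq_empty_of_forall_notMem fun x hx => hC hx.inv

omit [Countable U] [Group.FG Γ] in
-- Closedness makes an implication with intertwining as its hypothesis an open condition whenever
-- its conclusion is open.
theorem isClosed_intertwines (hr : ∀ γ u v, IsOpen {x | r x γ u = v})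
    (π : RepSpace Γ (AutGroup 𝔘.lang U)) (g : AutGroup 𝔘.lang U) (C : Finset U) :
    IsClosed {x | RepSpace.Intertwines π (r x) g C} := by
  rw [← isOpen_compl_iff, isOpen_iff_forall_mem_open]
  intro x hx
  by_cases hC : ∀ γ, ∀ c ∈ C, π γ c ∈ C
  · have : ∃ γ, ∃ c ∈ C, r x γ (g c) ≠ g (π γ c) := by
      by_contra! h
      exact hx ⟨hC, h⟩
    obtain ⟨γ, c, hc, hne⟩ := this
    exact ⟨{y | r y γ (g c) = r x γ (g c)}, fun y (hy : _ = _) hy' => hne (hy ▸ hy'.eq γ c hc),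
      hr _ _ _, rfl⟩
  · exact ⟨Set.univ, fun y _ hy => hC hy.inv, isOpen_univ, trivial⟩

/-- If representations with the extension property are dense in a family of representations, they
are comeagre. -/
theorem eventually_residual_isExtensive (hr : ∀ γ u v, IsOpen {x | r x γ u = v})
    (hd : Dense {x | IsExtensive hU (r x)}) : ∀ᶠ x in residual X, IsExtensive hU (r x) := by
  classical
  -- Instead of expressing `IsExtensive` by open conditions, one fixes an extensive `π` and asks
  -- that intertwiners from `π` extend; with finite orbits this forces conjugacy to `π`.
  obtain ⟨π, hπ, -⟩ := FinAct.exists_isExtensive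
    (⟨∅, 1, fun _ => Str.isEmb_id _⟩ : FinAct hU Γ)
  have h1 : ∀ᶠ x in residual X, ∀ u, (Set.range fun γ => r x γ u).Finite := by
    refine eventually_countable_forall.2 fun u => residual_of_dense_open ?_
      (hd.mono fun x hx => hx.finite_orbit u)
    rw [isOpen_iff_forall_mem_open]
    intro x hx
    let C := hx.toFinset
    have hC : ∀ γ, ∀ c ∈ C, r x γ c ∈ C := by
      intro γ c hc
      obtain ⟨δ, rfl⟩ := hx.mem_toFinset.1 hc
      exact hx.mem_toFinset.2 ⟨γ * δ, by simp⟩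
    -- Agreement with `r x` on the finite orbit `C` is an open condition that keeps the orbit of `u`
    -- inside `C`.
    refine ⟨{y | RepSpace.Intertwines (r x) (r y) 1 C}, fun y hy => ?_,
      isOpen_intertwines hr _ _ _, ⟨hC, fun _ _ _ => rfl⟩⟩
    refine C.finite_toSet.subset ?_
    rintro _ ⟨γ, rfl⟩
    have hu : u ∈ C := hx.mem_toFinset.2 ⟨1, by simp⟩
    have := hy.eq γ u hu
    simp only [AutGroup.one_apply] at this
    change r y γ u ∈ C
    exact this ▸ hC γ u hu
  have h2 : ∀ (g : AutGroup 𝔘.lang U) (B C : Finset U), ∀ᶠ x in residual X,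
      RepSpace.Intertwines π (r x) g B → B ⊆ C → (∀ γ, ∀ c ∈ C, π γ c ∈ C) →
        ∃ g' : AutGroup 𝔘.lang U, (∀ c ∈ B, g' c = g c) ∧
          RepSpace.Intertwines π (r x) g' C := by
    intro g B C
    by_cases hBC : B ⊆ C ∧ ∀ γ, ∀ c ∈ C, π γ c ∈ C
    swap
    · exact Filter.Eventually.of_forall fun x _ h h' => (hBC ⟨h, h'⟩).elim
    have : IsOpen ({x | RepSpace.Intertwines π (r x) g B}ᶜ ∪ ⋃ g' ∈
        {g' : AutGroup 𝔘.lang U | ∀ c ∈ B, g' c = g c},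
          {x | RepSpace.Intertwines π (r x) g' C}) :=
      (isClosed_intertwines hr _ _ _).isOpen_compl.union
        (isOpen_biUnion fun g' _ => isOpen_intertwines hr _ _ _)
    refine Filter.mem_of_superset (residual_of_dense_open this (hd.mono fun x hx => ?_)) ?_
    · by_cases hi : RepSpace.Intertwines π (r x) g B
      · obtain ⟨g', h, h'⟩ := hx.extend_intertwines hi hBC.1 hBC.2
        exact Or.inr (Set.mem_biUnion (x := g') h h')
      · exact Or.inl hi
    · rintro x (hx | hx) hi _ _
      · exact (hx hi).elim
      · obtain ⟨g', h, h'⟩ := Set.mem_iUnion₂.1 hx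
        exact ⟨g', h, h'⟩
  -- A requirement sees only a finite part of `g`. Choosing one automorphism for each extendable
  -- finite partial map leaves countably many requirements.
  have h3 : ∃ e : Finset (U × U) → AutGroup 𝔘.lang U, ∀ (g : AutGroup 𝔘.lang U) (B : Finset U),
      ∃ P, ∀ b ∈ B, e P b = g b := by
    have : ∀ P : Finset (U × U), ∃ g : AutGroup 𝔘.lang U,
        ∀ g' : AutGroup 𝔘.lang U, (∀ x ∈ P, g' x.1 = x.2) → ∀ x ∈ P, g x.1 = x.2 := fun P => by
      by_cases h : ∃ g' : AutGroup 𝔘.lang U, ∀ x ∈ P, g' x.1 = x.2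
      · obtain ⟨g', hg'⟩ := h
        exact ⟨g', fun _ _ => hg'⟩
      · exact ⟨1, fun g' hg' => (h ⟨g', hg'⟩).elim⟩
    choose e he using this
    refine ⟨e, fun g B => ⟨B.image fun b => (b, g b), fun b hb => ?_⟩⟩
    exact he (B.image fun b => (b, g b)) g (by simp) (b, g b) (Finset.mem_image_of_mem _ hb)
  obtain ⟨e, he⟩ := h3
  have h4 : ∀ᶠ x in residual X, ∀ P B C, RepSpace.Intertwines π (r x) (e P) B → B ⊆ C →
      (∀ γ, ∀ c ∈ C, π γ c ∈ C) → ∃ g' : AutGroup 𝔘.lang U, (∀ c ∈ B, g' c = e P c) ∧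
          RepSpace.Intertwines π (r x) g' C :=
    eventually_countable_forall.2 fun P => eventually_countable_forall.2 fun B =>
      eventually_countable_forall.2 fun C => h2 (e P) B C
  filter_upwards [h1, h4] with x hx1 hx4
  obtain ⟨g, -, hg⟩ := hπ.exists_conj_of_extend hx1 (fun g B C hB hBC hC => by
    obtain ⟨P, hP⟩ := he g B
    obtain ⟨g', h, h'⟩ := hx4 P B C ⟨hB.inv, fun γ b hb => by
      rw [hP b hb, hP _ (hB.inv γ b hb), hB.eq γ b hb]⟩ hBC hC
    exact ⟨g', fun c hc => (h c hc).trans (hP c hc), h'⟩) (g0 := 1) (B := ∅)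
    ⟨by simp, by simp⟩
  exact hπ.conj hg

end

/-! ### Density of extensive representations and genericity -/

theorem dense_isExtensive (hU : 𝔘.IsRandomisedUltrametricSpace U) :
    Dense {ρ : RepSpace Γ (AutGroup 𝔘.lang U) | IsExtensive hU ρ} := by
  classical
  refine dense_iff_inter_open.2 fun W hW ⟨σ, hσ⟩ => ?_
  obtain ⟨K, F, hKF⟩ := RepSpace.exists_finset_of_isOpen hW hσ
  -- The images under `K` are included because the approximation only records moves that stay inside
  -- the given set.
  obtain ⟨p, hp⟩ := FinAct.exists_approx hU σ (F ∪ K.biUnion fun γ => F.image (σ γ))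
  obtain ⟨ρ, hρ, hpρ⟩ := p.exists_isExtensive
  refine ⟨ρ, hKF ρ fun γ hγ x hx => hpρ _ _ _ (hp γ x (Finset.mem_union_left _ hx) ?_), hρ⟩
  exact Finset.mem_union_right _ (Finset.mem_biUnion.2 ⟨γ, hγ, Finset.mem_image_of_mem _ hx⟩)

/-- Representations with the extension property are generic. -/
theorem IsExtensive.isGeneric {π : RepSpace Γ (AutGroup 𝔘.lang U)} (hπ : IsExtensive hU π) :
    π.IsGeneric := by
  refine Filter.mem_of_superset (eventually_residual_isExtensive (r := fun ρ => ρ)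
    RepSpace.isOpen_apply_eq (dense_isExtensive hU)) fun ρ hρ => ?_
  obtain ⟨g, -, hg⟩ := hπ.exists_conj hρ (g0 := 1) (B := ∅) ⟨by simp, by simp⟩
  exact ⟨g, hg⟩

/-- A finite part of an extension of a representation with the extension property is also part of
an extension with the extension property. -/
theorem IsExtensive.exists_extension {Δ : Type v} [CommGroup Δ] {φ : Δ →* Γ}
    (hφ : Function.Injective φ) {π : RepSpace Δ (AutGroup 𝔘.lang U)} (hπ : IsExtensive hU π)
    {σ : RepSpace Γ (AutGroup 𝔘.lang U)} (hσ : ∀ δ, σ (φ δ) = π δ) (K : Finset Γ) (F : Finset U) :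
    ∃ ρ : RepSpace Γ (AutGroup 𝔘.lang U), IsExtensive hU ρ ∧ (∀ δ, ρ (φ δ) = π δ) ∧
      ∀ γ ∈ K, ∀ x ∈ F, ρ γ x = σ γ x := by
  classical
  obtain ⟨F1, hF1, hinv⟩ := RepSpace.exists_invariant hπ.finite_orbit F
  -- By commutativity of `Γ`, translating the `Δ`-invariant set `F1` by `K` again gives a
  -- `Δ`-invariant set.
  let F2 := F1 ∪ K.biUnion fun γ => F1.image (σ γ)
  have hF2 : ∀ δ, ∀ x ∈ F2, π δ x ∈ F2 := by
    intro δ x hx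
    rcases Finset.mem_union.1 hx with hx | hx
    · exact Finset.mem_union_left _ (hinv δ x hx)
    · obtain ⟨γ, hγ, hx⟩ := Finset.mem_biUnion.1 hx
      obtain ⟨y, hy, rfl⟩ := Finset.mem_image.1 hx
      refine Finset.mem_union_right _ (Finset.mem_biUnion.2 ⟨γ, hγ, Finset.mem_image.2
        ⟨π δ y, hinv δ y hy, ?_⟩⟩)
      rw [← hσ, ← AutGroup.mul_apply, ← map_mul, mul_comm, map_mul, AutGroup.mul_apply]
  obtain ⟨p, hp⟩ := FinAct.exists_approx hU σ F2
  let q : FinAct hU Δ := ⟨p.carrier, p.act.comp φ, fun δ => p.isAct (φ δ)⟩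
  -- The approximation `p` agrees with `π` on `F2` but need not do so elsewhere; `g` moves it,
  -- fixing `F2`, so that its restriction to `Δ` becomes part of `π`.
  obtain ⟨g, hg, hg'⟩ := hπ.extend q F2 fun δ a ha =>
    ⟨hF2 δ a ha, by
      have := hp (φ δ) a ha (by rw [hσ]; exact hF2 δ a ha)
      rwa [hσ] at this⟩
  obtain ⟨p', hp'⟩ := p.exists_map g
  obtain ⟨ρ, hρ, hpρ⟩ := p'.exists_isExtensive
  have hρg : ∀ γ u v, p.Rel γ u v → ρ γ (g u) = g v := fun γ u v h =>
    hpρ _ _ _ ((hp' _ _ _).2 h)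
  let π' : RepSpace Δ (AutGroup 𝔘.lang U) := MonoidHom.comp (show Γ →* _ from ρ) φ
  -- The restriction of `ρ` and `π` are both extensive and agree on the moved carrier, so they are
  -- conjugate by some `k` fixing it. Conjugating `ρ` by `k` gives an exact extension of `π` with
  -- unchanged values there.
  obtain ⟨k, hk, hk'⟩ := (hρ.comp hφ (π := π') fun _ => rfl).exists_conj hπ (g0 := 1)
    (B := p.carrier.image g) ⟨fun δ b hb => by
      obtain ⟨u, hu, rfl⟩ := Finset.mem_image.1 hb
      obtain ⟨v, hv⟩ := p.exists_rel (φ δ) hu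
      rw [show π' δ (g u) = g v from hρg _ _ _ hv]
      exact Finset.mem_image_of_mem _ hv.right_mem, fun δ b hb => by
      obtain ⟨u, hu, rfl⟩ := Finset.mem_image.1 hb
      obtain ⟨v, hv⟩ := p.exists_rel (φ δ) hu
      rw [show π' δ (g u) = g v from hρg _ _ _ hv]
      exact hg' δ u v hv⟩
  have hkg : ∀ x ∈ F2, k x = x := fun x hx => by
    have hx' : x ∈ p.carrier := (hp 1 x hx (by simpa using hx)).left_mem
    exact hk x (Finset.mem_image.2 ⟨x, hx', hg x hx⟩)
  let ρ' : RepSpace Γ (AutGroup 𝔘.lang U) :=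
    MonoidHom.comp (MulAut.conj k).toMonoidHom (show Γ →* _ from ρ)
  have hρ' : ∀ γ, ρ' γ = k * ρ γ * k⁻¹ := fun γ => rfl
  refine ⟨ρ', hρ.conj hρ', fun δ => (hk' δ).symm, fun γ hγ x hx => ?_⟩
  have hx2 : x ∈ F2 := Finset.mem_union_left _ (hF1 hx)
  have hy2 : σ γ x ∈ F2 := Finset.mem_union_right _
    (Finset.mem_biUnion.2 ⟨γ, hγ, Finset.mem_image_of_mem _ (hF1 hx)⟩)
  have h1 := hρg _ _ _ (hp γ x hx2 hy2)
  rw [hg x hx2, hg _ hy2] at h1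
  have h2 : (k⁻¹ : AutGroup 𝔘.lang U) x = x := by
    conv_lhs => rw [← hkg x hx2]
    exact AutGroup.inv_apply_self _ _
  rw [hρ', AutGroup.mul_apply, AutGroup.mul_apply, h2, h1, hkg _ hy2]

end UTuple

theorem mainTheorem4 (𝔘 : UTuple) {U : Type*} [𝔘.lang.Structure U] [Countable U]
    (hU : 𝔘.IsRandomisedUltrametricSpace U)
    {Γ : Type*} [CommGroup Γ] [Group.FG Γ] :
    (∃ π : RepSpace Γ (AutGroup 𝔘.lang U), π.IsGeneric ∧
      ∀ u : U, (Set.range fun γ : Γ => π γ u).Finite) ∧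
    ∀ Δ Λ : Subgroup Γ, Δ.FG → Λ.FG →
      ∀ᶠ π in residual (RepSpace Δ (AutGroup 𝔘.lang U)),
        ∀ᶠ σ in residual (RepSpace.fibre Λ π),
          ∃ ρ : RepSpace ↥(Δ ⊔ Λ) (AutGroup 𝔘.lang U), RepSpace.IsProd π σ.1 ρ ∧ ρ.IsGeneric := by
  classical
  constructor
  · obtain ⟨π, hπ, -⟩ := UTuple.FinAct.exists_isExtensive
      (⟨∅, 1, fun _ => UTuple.Str.isEmb_id _⟩ : UTuple.FinAct hU Γ)
    exact ⟨π, hπ.isGeneric, hπ.finite_orbit⟩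
  intro Δ Λ hΔ hΛ
  have : Group.FG Δ := (Group.fg_iff_subgroup_fg _).2 hΔ
  have : Group.FG ↥(Δ ⊔ Λ) := (Group.fg_iff_subgroup_fg _).2 (hΔ.sup hΛ)
  filter_upwards [UTuple.eventually_residual_isExtensive (r := fun ρ => ρ)
    RepSpace.isOpen_apply_eq (UTuple.dense_isExtensive hU)] with π hπ
  choose r hr using fun σ : RepSpace.fibre Λ π => σ.2
  have hrΔ : ∀ σ (δ : Δ), r σ (Subgroup.inclusion le_sup_left δ) = π δ := fun σ δ =>
    DFunLike.congr_fun (hr σ).1 δ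
  have hrΛ : ∀ σ (μ : Λ), r σ (Subgroup.inclusion le_sup_right μ) = σ.1 μ := fun σ μ =>
    DFunLike.congr_fun (hr σ).2 μ
  have hdec : ∀ γ : ↥(Δ ⊔ Λ), ∃ (δ : Δ) (μ : Λ),
      γ = Subgroup.inclusion le_sup_left δ * Subgroup.inclusion le_sup_right μ := fun γ => by
    obtain ⟨x, hx, y, hy, h⟩ := Subgroup.mem_sup.1 γ.2
    exact ⟨⟨x, hx⟩, ⟨y, hy⟩, Subtype.ext h.symm⟩
  -- On the fibre `π` is constant, so after writing `γ` as a product from `Δ` and `Λ`, a value of `r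
  -- σ γ` is governed by one value of `σ`.
  have key := UTuple.eventually_residual_isExtensive (hU := hU) (r := r) (fun γ u v => by
      obtain ⟨δ, μ, rfl⟩ := hdec γ
      have : {σ | r σ (Subgroup.inclusion le_sup_left δ * Subgroup.inclusion le_sup_right μ) u = v}
          = Subtype.val ⁻¹' {σ : RepSpace Λ (AutGroup 𝔘.lang U) | σ μ u = (π δ)⁻¹ v} := by
        ext σ
        simp only [Set.mem_ofPred_eq, Set.mem_preimage, map_mul, hrΔ, hrΛ, AutGroup.mul_apply]
        constructor
        · rintro rfl
          exact (AutGroup.inv_apply_self _ _).symm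
        · intro h
          rw [h, AutGroup.apply_inv_self]
      rw [this]
      exact (RepSpace.isOpen_apply_eq μ u _).preimage continuous_subtype_val)
    (by
      refine dense_iff_inter_open.2 ?_
      rintro _ ⟨W, hW, rfl⟩ ⟨σ, hσ⟩
      obtain ⟨K, F, hKF⟩ := RepSpace.exists_finset_of_isOpen hW hσ
      obtain ⟨ρ, hρ, hρπ, hρσ⟩ := hπ.exists_extension
        (φ := Subgroup.inclusion (le_sup_left : Δ ≤ Δ ⊔ Λ)) (Subgroup.inclusion_injective _)
        (hrΔ σ) (K.image (Subgroup.inclusion (le_sup_right : Λ ≤ Δ ⊔ Λ))) F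
      have hρ' : RepSpace.IsProd π (ρ.restrict le_sup_right) ρ := ⟨DFunLike.ext _ _ hρπ, rfl⟩
      let σ' : RepSpace.fibre Λ π := ⟨ρ.restrict le_sup_right, ρ, hρ'⟩
      -- The chosen product representation is unique, since `Δ` and `Λ` generate.
      have e : r σ' = ρ := DFunLike.ext _ _ fun γ => by
        obtain ⟨δ, μ, rfl⟩ := hdec γ
        rw [map_mul, map_mul, hrΔ, hrΛ, hρπ]
        rfl
      refine ⟨σ', hKF _ fun μ hμ x hx => ?_, ?_⟩
      · exact (hρσ _ (Finset.mem_image_of_mem _ hμ) x hx).trans (by rw [hrΛ])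
      · change UTuple.IsExtensive hU (r σ')
        rwa [e])
  filter_upwards [key] with σ hσ
  exact ⟨r σ, hr σ, hσ.isGeneric⟩
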